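/- Write $e(x)=e^{2\pi i x}$ and let $\|x\|$ denote the distance from a real number $x$ to the nearest integer. For integers $b\ge 2$, $N\ge 0$ and real $\alpha$ put $$\phi_b(\alpha)=\Big|\sum_{0\le m<b}e(\alpha m)\Big|,\qquad \Phi_N(\alpha)=\prod_{1\le n<N}\phi_b\big(\alpha(b^n+b^{2N-n})\big),$$ with $\Phi_N=1$ for $N\le 1$; $\Phi_N$ has period $1$. Points $\alpha_1,\dots,\alpha_R\in\mathbb{R}/\mathbb{Z}$ are called $\delta$-spaced if $\|\alpha_r-\alpha_s\|\ge\delta$ whenever $r\ne s$. There is an absolute constant $C>0$ such that the following holds for all integers $N,K,b\ge 2$. Set $$B=b^{2(K-1)N+2}\left(1+C\left(\frac{1}{\sqrt K}+\frac{b^2}{K}\right)\right)^{2N}.$$ (i) We have $$\int_0^1\Phi_N^{2K}(\alpha)\,d\alpha\le B.$$ (ii) If $0<\delta\le 1/2$ and $\alpha_1,\dots,\alpha_R\in\mathbb{R}/\mathbb{Z}$ are $\delta$-spaced, then $$\sum_{r=1}^R\Phi_N^{2K}(\alpha_r)\le\left(\delta^{-1}+Kb^{2N}\right)B.$$ (iii)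 For every real $Q\ge 1$ and every real $\beta$, $$\sum_{1\le q\le Q}\ \sum_{\substack{0\le h<q\\ (h,q)=1}}\Phi_N^{2K}\left(\frac hq+\beta\right)\le\left(Q^2+Kb^{2N}\right)B.$$ -/

import Mathlib

open Finset

/-- The additive character `e(x) = exp(2πix)`. -/
noncomputable def expChar (x : ℝ) : ℂ :=
  Complex.exp (2 * (Real.pi : ℂ) * Complex.I * (x : ℂ))

/-- `φ_b(α) = |∑_{0 ≤ m < b} e(α m)|`. -/
noncomputable def phi (b : ℕ) (α : ℝ) : ℝ :=
  ‖∑ m ∈ range b, expChar (α * (m : ℝ))‖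

/-- `Φ_N(α) = ∏_{1 ≤ n < N} φ_b(α (b^n + b^(2N-n)))`; the product is `1` for `N ≤ 1`. -/
noncomputable def bigPhi (b N : ℕ) (α : ℝ) : ℝ :=
  ∏ n ∈ Ico 1 N, phi b (α * ((b : ℝ) ^ n + (b : ℝ) ^ (2 * N - n)))

/-- `‖x‖`, the distance from the real number `x` to the nearest integer. -/
noncomputable def distNearestInt (x : ℝ) : ℝ := |x - (round x : ℝ)|

/-- The points of `ℝ/ℤ` represented by the reals `α₁, …, α_R` are `δ`-spaced. -/
def IsSpaced {R : ℕ} (δ : ℝ) (α : Fin R → ℝ) : Prop :=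
  ∀ r s : Fin R, r ≠ s → δ ≤ distNearestInt (α r - α s)

/-- The bound `b^(2(K-1)N+2) (1 + C (1/√K + b²/K))^(2N)`, where `C` is the implied constant. -/
noncomputable def momentBound (C : ℝ) (N K b : ℕ) : ℝ :=
  (b : ℝ) ^ (2 * (K - 1) * N + 2) *
    (1 + C * (1 / Real.sqrt (K : ℝ) + (b : ℝ) ^ 2 / (K : ℝ))) ^ (2 * N)

/-!
Write `A_k` for the number of representations of `k` as a sum of `2K` digits, so that
`φ_b(θ)^(2K) = ∑_k A_k e(θ(k - K(b-1)))`. The moment of `Φ_N` then counts the solutions of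
`∑_{1 ≤ n < N} s_n (b^n + b^(2N-n)) = 0`, the variable `s_n = k - K(b-1)` having weight `A_k`. Choosing
`s_1, s_2, …` in turn, a partial choice matters only through two integers: the carry `V` from the low
end, which has to make `V + s_n` divisible by `b`, and the partial sum `U` at the high end, which
moves to `b U + s_n` (`integral_bigPhi_mul_expChar`).

Two facts bound the resulting transfer operator.

* The weights are dominated by a Gaussian, uniformly in `k`: `A_k` is at most `b^(2K) (1 + O(1/√K))`
  times the Gaussian density of variance `σ² = K(b² - 1)/6 · (1 + 1/√K)` (`exists_digitSumCount_le`).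
  Tilt the digits by `e^(tm)` with `t = s/σ²`. The moment generating function of a digit is bounded by
  that of the Gaussian with the same variance (`sum_exp_mul_digit_le`), and the tilted integral is
  estimated by Laplace's method (`exists_integral_kernel_le`). The tilt changes the second-order term at
  the origin by a factor at most `e^(O(|t|b))`, and the enlargement of the variance by `1 + 1/√K` absorbs
  this loss.
* For Gaussian weights the Gaussian of variance `σ²/(b² - 1)` in `U` is an eigenfunction up to the
  effect of the congruence condition on `s_n`. Completing the square leaves the sum of a Gaussian over a
  shifted lattice of step `b`, which by Poisson summation exceeds the expected value by a factor at most
  `1 + O(b²/K)` (`tsum_exp_neg_mul_int_add_sq_le`, `exists_transfer_gaussian_le`).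

So every step multiplies the count by at most `b^(2K-2) (1 + O(1/√K)) (1 + O(b²/K))`, and comparing the
Gaussian with the final condition `b U + V = 0`, where `|V| ≤ K`, costs a factor `e^(3K/b²)` once. The
factor `b^(2K)` which the claimed bound has to spare exceeds this by more than the factor lost in the
large sieve inequality `large_sieve` (Gallagher's method), which passes from the mean value to spaced
points and to fractions with small denominators. All this is for `K ≥ max(b, 100)`; for smaller `K` the
trivial bound `Φ_N ≤ b^(N-1)` suffices.
-/

/-! ### Gaussian sums over shifted lattices -/

theorem summable_exp_neg_mul_int_sq {a : ℝ} (ha : 0 < a) :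
    Summable fun n : ℤ => Real.exp (-Real.pi * a * (n : ℝ) ^ 2) := by
  refine (summable_pow_mul_jacobiTheta₂_term_bound 0 ha 0).congr fun n => ?_
  rw [pow_zero, one_mul]
  congr 1
  ring

theorem summable_exp_neg_mul_int_add_sq {a : ℝ} (ha : 0 < a) (ν : ℝ) :
    Summable fun n : ℤ => Real.exp (-Real.pi / a * ((n : ℝ) + ν) ^ 2) := by
  have h := (summable_exp_neg_mul_int_sq (a := 1 / (2 * a)) (by positivity)).mul_left
    (Real.exp (Real.pi / a * ν ^ 2))
  refine h.of_nonneg_of_le (fun n => (Real.exp_pos _).le) fun n => ?_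
  rw [← Real.exp_add]
  apply Real.exp_le_exp.mpr
  have h1 : 0 ≤ Real.pi / a * (((n : ℝ) + 2 * ν) ^ 2 / 2) := by positivity
  have h2 : Real.pi / a * ν ^ 2 + -Real.pi * (1 / (2 * a)) * (n : ℝ) ^ 2
      - (-Real.pi / a * ((n : ℝ) + ν) ^ 2) = Real.pi / a * (((n : ℝ) + 2 * ν) ^ 2 / 2) := by
    field_simp
    ring
  linarith

theorem tsum_exp_neg_mul_int_sq_le {a : ℝ} (ha : 0 < a) :
    ∑' n : ℤ, Real.exp (-Real.pi * a * (n : ℝ) ^ 2) ≤ 1 + 2 / a := by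
  have hz : HasSum (fun n : ℕ => 1 / (Real.pi * a) * (1 / ((n : ℝ) + 1) ^ 2))
      (1 / (Real.pi * a) * (Real.pi ^ 2 / 6)) := by
    refine HasSum.mul_left _ ?_
    have := (hasSum_nat_add_iff' (f := fun n : ℕ => 1 / (n : ℝ) ^ 2) 1).mpr hasSum_zeta_two
    simpa using this
  have hbd : ∀ n : ℕ, Real.exp (-Real.pi * a * ((n : ℝ) + 1) ^ 2) ≤
      1 / (Real.pi * a) * (1 / ((n : ℝ) + 1) ^ 2) := fun n => by
    have hy : 0 < Real.pi * a * ((n : ℝ) + 1) ^ 2 := by positivity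
    have h1 := Real.add_one_le_exp (Real.pi * a * ((n : ℝ) + 1) ^ 2)
    rw [show -Real.pi * a * ((n : ℝ) + 1) ^ 2 = -(Real.pi * a * ((n : ℝ) + 1) ^ 2) by ring,
      Real.exp_neg, ← one_div, one_div_mul_one_div]
    exact one_div_le_one_div_of_le hy (by linarith)
  have hsum : Summable fun n : ℕ => Real.exp (-Real.pi * a * ((n : ℝ) + 1) ^ 2) :=
    hz.summable.of_nonneg_of_le (fun n => (Real.exp_pos _).le) hbd
  have hle : ∑' n : ℕ, Real.exp (-Real.pi * a * ((n : ℝ) + 1) ^ 2) ≤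
      1 / (Real.pi * a) * (Real.pi ^ 2 / 6) := by
    rw [← hz.tsum_eq]
    exact hsum.tsum_le_tsum hbd hz.summable
  rw [tsum_of_add_one_of_neg_add_one]
  · have e : ∀ n : ℕ, Real.exp (-Real.pi * a * (((-((n : ℤ) + 1) : ℤ)) : ℝ) ^ 2) =
        Real.exp (-Real.pi * a * ((n : ℝ) + 1) ^ 2) := fun n => by
      push_cast
      congr 1
      ring
    simp only [e]
    push_cast
    have h0 : Real.exp (-Real.pi * a * (0 : ℝ) ^ 2) = 1 := by simp
    rw [h0]
    have h3 : 1 / (Real.pi * a) * (Real.pi ^ 2 / 6) = (Real.pi / 6) / a := by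
      field_simp
    have h4 : (Real.pi / 6) / a ≤ 1 / a := by
      gcongr
      linarith [Real.pi_le_four]
    have h5 : 2 / a = 1 / a + 1 / a := by ring
    linarith
  · simpa using hsum
  · refine hsum.congr fun n => ?_
    push_cast
    congr 1
    ring

/-- By Poisson summation the sum of a Gaussian over a shifted lattice is at most the sum over the
lattice of its Fourier transform; all frequencies except `0` are negligible when `a` is large. -/
theorem tsum_exp_neg_mul_int_add_sq_le {a : ℝ} (ha : 0 < a) (ν : ℝ) :
    ∑' n : ℤ, Real.exp (-Real.pi / a * ((n : ℝ) + ν) ^ 2) ≤ Real.sqrt a * (1 + 2 / a) := by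
  have hP := Complex.tsum_exp_neg_quadratic (a := (a : ℂ)) (by simpa using ha)
    (-(Complex.I * (ν : ℂ)))
  have h1 : ∀ n : ℤ, Complex.exp (-(Real.pi : ℂ) / a *
      ((n : ℂ) + Complex.I * -(Complex.I * (ν : ℂ))) ^ 2) =
      ((Real.exp (-Real.pi / a * ((n : ℝ) + ν) ^ 2) : ℝ) : ℂ) := fun n => by
    push_cast
    congr 3
    linear_combination (-(ν : ℂ)) * Complex.I_mul_I
  simp only [h1] at hP
  rw [← Complex.ofReal_tsum] at hP
  have h2 : ((a : ℂ) ^ (1 / 2 : ℂ)) = ((Real.sqrt a : ℝ) : ℂ) := by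
    rw [Real.sqrt_eq_rpow, Complex.ofReal_cpow ha.le]
    norm_num
  rw [h2] at hP
  have hs : 0 < Real.sqrt a := Real.sqrt_pos.mpr ha
  have hn : ∀ n : ℤ, ‖Complex.exp (-(Real.pi : ℂ) * a * (n : ℂ) ^ 2 +
      2 * Real.pi * -(Complex.I * (ν : ℂ)) * n)‖ = Real.exp (-Real.pi * a * (n : ℝ) ^ 2) :=
    fun n => by
    rw [Complex.norm_exp]
    congr 1
    have : -(Real.pi : ℂ) * a * (n : ℂ) ^ 2 + 2 * Real.pi * -(Complex.I * (ν : ℂ)) * n =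
      ((-Real.pi * a * (n : ℝ) ^ 2 : ℝ) : ℂ) + ((-(2 * Real.pi * ν * n) : ℝ) : ℂ) * Complex.I := by
      push_cast
      ring
    rw [this, Complex.add_re, Complex.ofReal_re, Complex.re_ofReal_mul, Complex.I_re]
    ring
  have hle := norm_tsum_le_tsum_norm (f := fun n : ℤ => Complex.exp (-(Real.pi : ℂ) * a * (n : ℂ) ^ 2 +
      2 * Real.pi * -(Complex.I * (ν : ℂ)) * n))
      (by simpa only [hn] using summable_exp_neg_mul_int_sq ha)
  rw [hP] at hle
  simp only [hn] at hle
  have h0 : 0 ≤ ∑' n : ℤ, Real.exp (-Real.pi / a * ((n : ℝ) + ν) ^ 2) :=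
    tsum_nonneg fun n => (Real.exp_pos _).le
  rw [norm_mul, norm_div, norm_one, Complex.norm_real, Complex.norm_real, Real.norm_of_nonneg hs.le,
    Real.norm_of_nonneg h0] at hle
  have h3 := hle.trans (tsum_exp_neg_mul_int_sq_le ha)
  rw [one_div, inv_mul_le_iff₀ hs] at h3
  exact h3

/-! ### Exponential sums over the digits -/

theorem cos_le_one_sub_sq_add_pow_four (x : ℝ) : Real.cos x ≤ 1 - x ^ 2 / 2 + x ^ 4 / 24 := by
  have hsin : ∀ y : ℝ, 0 ≤ y → y - y ^ 3 / 6 ≤ Real.sin y := by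
    intro y hy
    have hm : MonotoneOn (fun y : ℝ => Real.sin y - (y - y ^ 3 / 6)) (Set.Ici 0) := by
      refine monotoneOn_of_deriv_nonneg (convex_Ici 0) (by fun_prop) (by fun_prop) fun z _ => ?_
      have : HasDerivAt (fun y : ℝ => Real.sin y - (y - y ^ 3 / 6))
          (Real.cos z - (1 - 3 * z ^ 2 / 6)) z := by
        have := (Real.hasDerivAt_sin z).sub ((hasDerivAt_id z).sub ((hasDerivAt_pow 3 z).div_const 6))
        exact this.congr_deriv (by norm_num)
      rw [this.deriv]
      have := @Real.one_sub_sq_div_two_le_cos z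
      linarith
    have := hm (Set.self_mem_Ici) hy hy
    simp at this
    linarith
  have hpos : ∀ y : ℝ, 0 ≤ y → Real.cos y ≤ 1 - y ^ 2 / 2 + y ^ 4 / 24 := by
    intro y hy
    have hm : MonotoneOn (fun y : ℝ => 1 - y ^ 2 / 2 + y ^ 4 / 24 - Real.cos y) (Set.Ici 0) := by
      refine monotoneOn_of_deriv_nonneg (convex_Ici 0) (by fun_prop) (by fun_prop) fun z hz => ?_
      have : HasDerivAt (fun y : ℝ => 1 - y ^ 2 / 2 + y ^ 4 / 24 - Real.cos y)
          (-(2 * z / 2) + 4 * z ^ 3 / 24 - -Real.sin z) z := by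
        have := ((((hasDerivAt_pow 2 z).div_const 2).const_sub 1).add
          ((hasDerivAt_pow 4 z).div_const 24)).sub (Real.hasDerivAt_cos z)
        exact this.congr_deriv (by norm_num)
      rw [this.deriv]
      rw [interior_Ici] at hz
      have := hsin z (le_of_lt hz)
      linarith
    have := hm (Set.self_mem_Ici) hy hy
    simp at this
    linarith
  rcases le_total 0 x with h | h
  · exact hpos x h
  · have := hpos (-x) (by linarith)
    rw [Real.cos_neg] at this
    nlinarith [this]

theorem expChar_add (x y : ℝ) : expChar (x + y) = expChar x * expChar y := by
  unfold expChar
  rw [← Complex.exp_add]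
  congr 1
  push_cast
  ring

theorem expChar_zero : expChar 0 = 1 := by simp [expChar]

theorem expChar_int (n : ℤ) : expChar n = 1 := by
  unfold expChar
  rw [Complex.exp_eq_one_iff]
  exact ⟨n, by push_cast; ring⟩

theorem expChar_eq_exp_ofReal_mul_I (x : ℝ) :
    expChar x = Complex.exp (((2 * Real.pi * x : ℝ) : ℂ) * Complex.I) := by
  unfold expChar
  congr 1
  push_cast
  ring

theorem norm_expChar (x : ℝ) : ‖expChar x‖ = 1 := by
  rw [expChar_eq_exp_ofReal_mul_I, Complex.norm_exp_ofReal_mul_I]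

theorem expChar_re (x : ℝ) : (expChar x).re = Real.cos (2 * Real.pi * x) := by
  rw [expChar_eq_exp_ofReal_mul_I, Complex.exp_ofReal_mul_I_re]

theorem conj_expChar (x : ℝ) : (starRingEnd ℂ) (expChar x) = expChar (-x) := by
  rw [expChar_eq_exp_ofReal_mul_I, expChar_eq_exp_ofReal_mul_I, ← Complex.exp_conj, map_mul,
    Complex.conj_ofReal, Complex.conj_I]
  congr 1
  push_cast
  ring

theorem expChar_pow (x : ℝ) (n : ℕ) : expChar x ^ n = expChar (x * n) := by
  unfold expChar
  rw [← Complex.exp_nat_mul]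
  congr 1
  push_cast
  ring

theorem expChar_add_int (x : ℝ) (n : ℤ) : expChar (x + n) = expChar x := by
  rw [expChar_add, expChar_int, mul_one]

theorem continuous_expChar : Continuous expChar := by
  unfold expChar
  fun_prop

theorem phi_nonneg (b : ℕ) (θ : ℝ) : 0 ≤ phi b θ := norm_nonneg _

theorem phi_le (b : ℕ) (θ : ℝ) : phi b θ ≤ b := by
  unfold phi
  refine (norm_sum_le _ _).trans ?_
  simp [norm_expChar]

theorem phi_add_int (b : ℕ) (θ : ℝ) (n : ℤ) : phi b (θ + n) = phi b θ := by
  unfold phi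
  congr 1
  refine sum_congr rfl fun m _ => ?_
  rw [add_mul, show (n : ℝ) * (m : ℝ) = ((n * (m : ℤ) : ℤ) : ℝ) by push_cast; ring, expChar_add_int]

theorem continuous_phi (b : ℕ) : Continuous (phi b) := by
  unfold phi
  exact continuous_norm.comp (continuous_finsetSum _ fun m _ =>
    continuous_expChar.comp (by fun_prop))

/-- The square of the modulus of a weighted digit sum, expanded over pairs of digits. -/
theorem norm_sum_mul_expChar_sq (s : Finset ℕ) (c : ℕ → ℝ) (θ : ℝ) :
    ‖∑ m ∈ s, (c m : ℂ) * expChar (θ * m)‖ ^ 2 =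
      ∑ m ∈ s, ∑ k ∈ s, c m * c k * Real.cos (2 * Real.pi * (θ * (m - k))) := by
  have h : ((‖∑ m ∈ s, (c m : ℂ) * expChar (θ * m)‖ ^ 2 : ℝ) : ℂ) =
      ∑ m ∈ s, ∑ k ∈ s, ((c m * c k : ℝ) : ℂ) * expChar (θ * (m - k)) := by
    rw [Complex.ofReal_pow, ← Complex.mul_conj', map_sum, sum_mul_sum]
    refine sum_congr rfl fun m _ => sum_congr rfl fun k _ => ?_
    rw [map_mul, conj_expChar, Complex.conj_ofReal, mul_sub, sub_eq_add_neg, expChar_add]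
    push_cast
    ring
  have h2 := congrArg Complex.re h
  rw [Complex.ofReal_re] at h2
  rw [h2, Complex.re_sum]
  refine sum_congr rfl fun m _ => ?_
  rw [Complex.re_sum]
  refine sum_congr rfl fun k _ => ?_
  rw [Complex.re_ofReal_mul, expChar_re]

theorem phi_sq (b : ℕ) (θ : ℝ) :
    phi b θ ^ 2 = ∑ m ∈ range b, ∑ k ∈ range b, Real.cos (2 * Real.pi * (θ * ((m : ℝ) - k))) := by
  have := norm_sum_mul_expChar_sq (range b) (fun _ => 1) θ
  simpa [phi] using this

theorem sum_sum_digit_sub_sq (b : ℕ) :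
    ∑ m ∈ range b, ∑ k ∈ range b, ((m : ℝ) - k) ^ 2 = (b : ℝ) ^ 2 * ((b : ℝ) ^ 2 - 1) / 6 := by
  have h1 : ∀ n : ℕ, ∑ m ∈ range n, (m : ℝ) = n * (n - 1) / 2 := fun n => by
    induction n with
    | zero => simp
    | succ n ih => rw [sum_range_succ, ih]; push_cast; ring
  have h2 : ∀ n : ℕ, ∑ m ∈ range n, (m : ℝ) ^ 2 = n * (n - 1) * (2 * n - 1) / 6 := fun n => by
    induction n with
    | zero => simp
    | succ n ih => rw [sum_range_succ, ih]; push_cast; ring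
  have h3 : ∀ m : ℕ, ∑ k ∈ range b, ((m : ℝ) - k) ^ 2 =
      b * (m : ℝ) ^ 2 - 2 * (b * (b - 1) / 2) * m + b * (b - 1) * (2 * b - 1) / 6 := fun m => by
    have : ∀ k : ℕ, ((m : ℝ) - k) ^ 2 = (m : ℝ) ^ 2 - 2 * m * k + (k : ℝ) ^ 2 := fun k => by ring
    simp only [this, sum_add_distrib, sum_sub_distrib, ← mul_sum, h1, h2]
    simp
    ring
  simp only [h3, sum_add_distrib, sum_sub_distrib, ← mul_sum, h1, h2]
  simp
  ring

theorem sq_sub_phi_sq (b : ℕ) (θ : ℝ) : (b : ℝ) ^ 2 - phi b θ ^ 2 =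
    ∑ m ∈ range b, ∑ k ∈ range b, (1 - Real.cos (2 * Real.pi * (θ * ((m : ℝ) - k)))) := by
  simp only [sum_sub_distrib, phi_sq]
  simp [pow_two]

/-- Near the origin `φ_b` decays like a Gaussian whose variance is that of a uniform digit. -/
theorem le_sq_sub_phi_sq (b : ℕ) (θ : ℝ) :
    (b : ℝ) ^ 2 * (Real.pi ^ 2 * θ ^ 2 * ((b : ℝ) ^ 2 - 1) / 3 *
      (1 - Real.pi ^ 2 * θ ^ 2 * (b : ℝ) ^ 2 / 3)) ≤ (b : ℝ) ^ 2 - phi b θ ^ 2 := by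
  rw [sq_sub_phi_sq]
  have hterm : ∀ m ∈ range b, ∀ k ∈ range b,
      2 * Real.pi ^ 2 * θ ^ 2 * (1 - Real.pi ^ 2 * θ ^ 2 * (b : ℝ) ^ 2 / 3) * ((m : ℝ) - k) ^ 2 ≤
        1 - Real.cos (2 * Real.pi * (θ * ((m : ℝ) - k))) := by
    intro m hm k hk
    have hm' : (m : ℝ) ≤ b := by exact_mod_cast (mem_range.mp hm).le
    have hk' : (k : ℝ) ≤ b := by exact_mod_cast (mem_range.mp hk).le
    have hD : ((m : ℝ) - k) ^ 2 ≤ (b : ℝ) ^ 2 := by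
      apply sq_le_sq'
      · linarith [(Nat.cast_nonneg m : (0 : ℝ) ≤ m)]
      · linarith [(Nat.cast_nonneg k : (0 : ℝ) ≤ k)]
    have hc := cos_le_one_sub_sq_add_pow_four (2 * Real.pi * (θ * ((m : ℝ) - k)))
    have h4 : 0 ≤ 2 * Real.pi ^ 4 * θ ^ 4 / 3 * (((m : ℝ) - k) ^ 2 *
        ((b : ℝ) ^ 2 - ((m : ℝ) - k) ^ 2)) :=
      mul_nonneg (by positivity) (mul_nonneg (sq_nonneg _) (by linarith))
    linarith
  calc _ = ∑ m ∈ range b, ∑ k ∈ range b, 2 * Real.pi ^ 2 * θ ^ 2 *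
        (1 - Real.pi ^ 2 * θ ^ 2 * (b : ℝ) ^ 2 / 3) * ((m : ℝ) - k) ^ 2 := by
        simp only [← mul_sum, sum_sum_digit_sub_sq]
        ring
    _ ≤ _ := sum_le_sum fun m hm => sum_le_sum fun k hk => hterm m hm k hk

theorem phi_mul_abs_le (b : ℕ) {θ : ℝ} (hθ : |θ| ≤ 1 / 2) : phi b θ * (2 * |θ|) ≤ 1 := by
  have hgeom : (∑ m ∈ range b, expChar (θ * m)) * (expChar θ - 1) = expChar θ ^ b - 1 := by
    rw [← geom_sum_mul]
    congr 1
    exact sum_congr rfl fun m _ => (expChar_pow θ m).symm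
  have h1 : ‖expChar θ - 1‖ = ‖2 * Real.sin (Real.pi * θ)‖ := by
    rw [expChar_eq_exp_ofReal_mul_I, mul_comm, Complex.norm_exp_I_mul_ofReal_sub_one]
    congr 3
    ring
  have h2 : 2 * (2 * |θ|) ≤ ‖expChar θ - 1‖ := by
    have h3 : |Real.pi * θ| ≤ Real.pi / 2 := by
      rw [abs_mul, abs_of_pos Real.pi_pos]
      nlinarith [Real.pi_pos]
    have := Real.mul_abs_le_abs_sin h3
    rw [abs_mul, abs_of_pos Real.pi_pos] at this
    have e : 2 / Real.pi * (Real.pi * |θ|) = 2 * |θ| := by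
      field_simp
    rw [h1, norm_mul, Real.norm_eq_abs, Real.norm_eq_abs, abs_of_pos (by norm_num : (0 : ℝ) < 2)]
    linarith
  have h4 := congrArg norm hgeom
  rw [norm_mul] at h4
  have h5 : ‖expChar θ ^ b - 1‖ ≤ 2 := by
    refine (norm_sub_le _ _).trans ?_
    rw [norm_pow, norm_expChar]
    norm_num
  have h6 := mul_le_mul_of_nonneg_left h2 (phi_nonneg b θ)
  unfold phi at h6 ⊢
  linarith

/-- Away from the integers `φ_b` is smaller than its maximum `b` by a definite factor. -/
theorem le_sq_sub_phi_sq_of_le {b : ℕ} (hb : 2 ≤ b) {θ η : ℝ} (hθ : |θ| ≤ 1 / 2) (hη0 : 0 < η)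
    (hη : η ≤ 1 / 2) (h : η ≤ b * |θ|) :
    (b : ℝ) ^ 2 * (η ^ 2 / 5) ≤ (b : ℝ) ^ 2 - phi b θ ^ 2 := by
  have hb' : (2 : ℝ) ≤ b := by exact_mod_cast hb
  have hb0 : (0 : ℝ) < b := by linarith
  have hpi1 := Real.pi_gt_d2
  have hpi2 := Real.pi_lt_d2
  have hpisq1 : 9.8 < Real.pi ^ 2 := by nlinarith
  have hpisq2 : Real.pi ^ 2 < 9.93 := by nlinarith
  rcases le_total (b * |θ|) 0.52 with hle | hge
  · refine le_trans ?_ (le_sq_sub_phi_sq b θ)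
    refine mul_le_mul_of_nonneg_left ?_ (by positivity)
    have hsq : θ ^ 2 * (b : ℝ) ^ 2 = (b * |θ|) ^ 2 := by
      rw [mul_pow, sq_abs]
      ring
    have hx1 : η ^ 2 ≤ (b * |θ|) ^ 2 := by gcongr
    have hx2 : (b * |θ|) ^ 2 ≤ 0.52 ^ 2 := by gcongr
    have hx3 : Real.pi ^ 2 * θ ^ 2 * (b : ℝ) ^ 2 / 3 ≤ 0.9 := by
      rw [mul_assoc, hsq]
      nlinarith [sq_nonneg (b * |θ|)]
    have hx4 : 3 / 4 * (θ ^ 2 * (b : ℝ) ^ 2) ≤ θ ^ 2 * ((b : ℝ) ^ 2 - 1) := by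
      have : 0 ≤ θ ^ 2 * ((b : ℝ) ^ 2 / 4 - 1) := mul_nonneg (sq_nonneg θ) (by nlinarith)
      linarith
    rw [hsq] at hx4
    have hx5 : η ^ 2 * (9.8 * (3 / 4) / 3) ≤ Real.pi ^ 2 * θ ^ 2 * ((b : ℝ) ^ 2 - 1) / 3 := by
      nlinarith [sq_nonneg θ, sq_nonneg η]
    have hx6 : η ^ 2 * (9.8 * (3 / 4) / 3) * (1 / 10) ≤ Real.pi ^ 2 * θ ^ 2 *
        ((b : ℝ) ^ 2 - 1) / 3 * (1 - Real.pi ^ 2 * θ ^ 2 * (b : ℝ) ^ 2 / 3) := by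
      refine mul_le_mul hx5 (by linarith) (by norm_num) (by nlinarith [sq_nonneg η])
    linarith [sq_nonneg η]
  · have h1 := phi_mul_abs_le b hθ
    have h2 : phi b θ * 1.04 ≤ b := by
      have : phi b θ * 1.04 ≤ phi b θ * (2 * (b * |θ|)) :=
        mul_le_mul_of_nonneg_left (by linarith) (phi_nonneg b θ)
      nlinarith
    have h3 : (phi b θ * 1.04) ^ 2 ≤ (b : ℝ) ^ 2 :=
      pow_le_pow_left₀ (mul_nonneg (phi_nonneg b θ) (by norm_num)) h2 2
    have h4 : (b : ℝ) ^ 2 * η ^ 2 ≤ (b : ℝ) ^ 2 * (1 / 2) ^ 2 := by gcongr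
    nlinarith

/-- A nonnegatively weighted digit sum has modulus at most that of its value at `0`, with a saving
controlled by the unweighted sum and the ratio of the weights. -/
theorem norm_sum_mul_expChar_sq_le {b : ℕ} (hb : 1 ≤ b) {c : ℕ → ℝ} {ρ : ℝ} (hc : ∀ m < b, 0 < c m)
    (hρ : 0 < ρ) (hcρ : ∀ m < b, ∀ k < b, c m ≤ ρ * c k) (θ : ℝ) :
    ‖∑ m ∈ range b, (c m : ℂ) * expChar (θ * m)‖ ^ 2 ≤
      (∑ m ∈ range b, c m) ^ 2 * (1 - (ρ⁻¹) ^ 2 * (1 - (phi b θ / b) ^ 2)) := by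
  have hb0 : (0 : ℝ) < b := by exact_mod_cast hb
  set Z := ∑ m ∈ range b, c m with hZ
  have hZ0 : 0 ≤ Z := sum_nonneg fun m hm => (hc m (mem_range.mp hm)).le
  have hZle : ∀ m < b, Z * (ρ⁻¹ / b) ≤ c m := fun m hm => by
    have : Z ≤ ∑ k ∈ range b, ρ * c m := sum_le_sum fun k hk => hcρ k (mem_range.mp hk) m hm
    rw [sum_const, card_range, nsmul_eq_mul] at this
    rw [← mul_div_assoc, div_le_iff₀ hb0, ← div_eq_mul_inv, div_le_iff₀ hρ]
    linarith
  have hdiff : Z ^ 2 - ‖∑ m ∈ range b, (c m : ℂ) * expChar (θ * m)‖ ^ 2 =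
      ∑ m ∈ range b, ∑ k ∈ range b,
        c m * c k * (1 - Real.cos (2 * Real.pi * (θ * ((m : ℝ) - k)))) := by
    rw [norm_sum_mul_expChar_sq, hZ, pow_two, sum_mul_sum]
    simp only [mul_sub, mul_one, sum_sub_distrib]
  have hlow : (Z * (ρ⁻¹ / b)) ^ 2 * ((b : ℝ) ^ 2 - phi b θ ^ 2) ≤
      Z ^ 2 - ‖∑ m ∈ range b, (c m : ℂ) * expChar (θ * m)‖ ^ 2 := by
    rw [hdiff, sq_sub_phi_sq, mul_sum]
    refine sum_le_sum fun m hm => ?_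
    rw [mul_sum]
    refine sum_le_sum fun k hk => ?_
    refine mul_le_mul_of_nonneg_right ?_ (by linarith [Real.cos_le_one (2 * Real.pi * (θ * ((m : ℝ) - k)))])
    rw [pow_two]
    exact mul_le_mul (hZle m (mem_range.mp hm)) (hZle k (mem_range.mp hk)) (by positivity)
      (hc m (mem_range.mp hm)).le
  have e : (Z * (ρ⁻¹ / b)) ^ 2 * ((b : ℝ) ^ 2 - phi b θ ^ 2) =
      Z ^ 2 * ((ρ⁻¹) ^ 2 * (1 - (phi b θ / b) ^ 2)) := by
    field_simp
  linarith

/-! ### The moment generating function of a digit -/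

theorem antitoneOn_sinh_div_mul_exp :
    AntitoneOn (fun y : ℝ => Real.sinh y / y * Real.exp (-(y ^ 2 / 6))) (Set.Ioi 0) := by
  have hcosh : ∀ y : ℝ, 0 ≤ y → Real.sinh y ≤ y * Real.cosh y := by
    intro y hy
    have hm : MonotoneOn (fun y : ℝ => y * Real.cosh y - Real.sinh y) (Set.Ici 0) := by
      refine monotoneOn_of_deriv_nonneg (convex_Ici 0) (by fun_prop) (by fun_prop) fun z hz => ?_
      have h := ((hasDerivAt_id z).mul (Real.hasDerivAt_cosh z)).sub (Real.hasDerivAt_sinh z)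
      have h' : HasDerivAt (fun y : ℝ => y * Real.cosh y - Real.sinh y) (z * Real.sinh z) z :=
        h.congr_deriv (by simp)
      rw [h'.deriv]
      rw [interior_Ici] at hz
      exact mul_nonneg (le_of_lt hz) (Real.sinh_nonneg_iff.mpr (le_of_lt hz))
    have := hm (Set.self_mem_Ici) hy hy
    simp at this
    linarith
  have hsinh : ∀ y : ℝ, 0 ≤ y → y * Real.cosh y ≤ Real.sinh y * (1 + y ^ 2 / 3) := by
    intro y hy
    have hm : MonotoneOn (fun y : ℝ => Real.sinh y * (1 + y ^ 2 / 3) - y * Real.cosh y)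
        (Set.Ici 0) := by
      refine monotoneOn_of_deriv_nonneg (convex_Ici 0) (by fun_prop) (by fun_prop) fun z hz => ?_
      have h := ((Real.hasDerivAt_sinh z).mul (((hasDerivAt_pow 2 z).div_const 3).const_add 1)).sub
        ((hasDerivAt_id z).mul (Real.hasDerivAt_cosh z))
      have h' : HasDerivAt (fun y : ℝ => Real.sinh y * (1 + y ^ 2 / 3) - y * Real.cosh y)
          (z / 3 * (z * Real.cosh z - Real.sinh z)) z :=
        h.congr_deriv (by simp; ring)
      rw [h'.deriv]
      rw [interior_Ici] at hz
      have hz' : 0 ≤ z := le_of_lt hz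
      exact mul_nonneg (by positivity) (by linarith [hcosh z hz'])
    have := hm (Set.self_mem_Ici) hy hy
    simp at this
    linarith
  have hder : ∀ z : ℝ, 0 < z → HasDerivAt
      (fun y : ℝ => Real.sinh y / y * Real.exp (-(y ^ 2 / 6)))
      (Real.exp (-(z ^ 2 / 6)) / z ^ 2 *
        (z * Real.cosh z - Real.sinh z * (1 + z ^ 2 / 3))) z := fun z hz => by
    have h := ((Real.hasDerivAt_sinh z).div (hasDerivAt_id z) hz.ne').mul
      (((hasDerivAt_pow 2 z).div_const 6).neg.exp)
    refine h.congr_deriv ?_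
    simp
    field_simp
    ring
  refine antitoneOn_of_deriv_nonpos (convex_Ioi 0)
    (fun z hz => (hder z hz).continuousAt.continuousWithinAt) ?_ ?_
  · rw [interior_Ioi]
    exact fun z hz => (hder z hz).differentiableAt.differentiableWithinAt
  · intro z hz
    rw [interior_Ioi] at hz
    rw [(hder z hz).deriv]
    exact mul_nonpos_of_nonneg_of_nonpos (by positivity) (by linarith [hsinh z (le_of_lt hz)])

/-- A uniform digit is sub-Gaussian with variance proxy equal to its variance `(b² - 1) / 12`. -/
theorem sum_exp_mul_digit_le {b : ℕ} (hb : 1 ≤ b) (t : ℝ) :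
    ∑ m ∈ range b, Real.exp (t * m) ≤
      b * Real.exp (t * ((b : ℝ) - 1) / 2) * Real.exp (((b : ℝ) ^ 2 - 1) * t ^ 2 / 24) := by
  have hb1 : (1 : ℝ) ≤ b := by exact_mod_cast hb
  have hpos : ∀ u : ℝ, 0 < u → ∑ m ∈ range b, Real.exp (u * m) ≤
      b * Real.exp (u * ((b : ℝ) - 1) / 2) * Real.exp (((b : ℝ) ^ 2 - 1) * u ^ 2 / 24) := by
    intro u hu
    have hs : 0 < Real.sinh (u / 2) := Real.sinh_pos_iff.mpr (by linarith)
    have hgeom : (∑ m ∈ range b, Real.exp (u * m)) * (2 * Real.sinh (u / 2)) =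
        Real.exp (u * ((b : ℝ) - 1) / 2) * (2 * Real.sinh (b * (u / 2))) := by
      have h1 : (∑ m ∈ range b, Real.exp (u * m)) * (Real.exp u - 1) = Real.exp (u * b) - 1 := by
        have := geom_sum_mul (Real.exp u) b
        rw [← Real.exp_nat_mul] at this
        rw [mul_comm u, ← this]
        congr 1
        refine sum_congr rfl fun m _ => ?_
        rw [← Real.exp_nat_mul, mul_comm]
      have h2 : ∀ x : ℝ, 2 * Real.sinh (x / 2) = Real.exp (-(x / 2)) * (Real.exp x - 1) := fun x => by
        rw [Real.sinh_eq, mul_sub, ← Real.exp_add]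
        ring_nf
      rw [show (b : ℝ) * (u / 2) = (u * b) / 2 by ring, h2, h2, ← h1]
      have h3 : Real.exp (u * ((b : ℝ) - 1) / 2) * Real.exp (-(u * b / 2)) = Real.exp (-(u / 2)) := by
        rw [← Real.exp_add]
        congr 1
        ring
      rw [← h3]
      ring
    have hanti := antitoneOn_sinh_div_mul_exp (a := u / 2) (b := b * (u / 2))
      (Set.mem_Ioi.mpr (by positivity)) (Set.mem_Ioi.mpr (by positivity)) (by nlinarith)
    simp only at hanti
    have e1 : Real.exp (((b : ℝ) ^ 2 - 1) * u ^ 2 / 24) =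
        Real.exp ((b * (u / 2)) ^ 2 / 6) * Real.exp (-((u / 2) ^ 2 / 6)) := by
      rw [← Real.exp_add]
      congr 1
      ring
    have hanti2 : Real.sinh (b * (u / 2)) ≤ b * Real.sinh (u / 2) *
        Real.exp (((b : ℝ) ^ 2 - 1) * u ^ 2 / 24) := by
      rw [Real.exp_neg, ← div_eq_mul_inv, div_le_iff₀ (Real.exp_pos _),
        div_le_iff₀ (by positivity)] at hanti
      rw [e1]
      refine hanti.trans (le_of_eq ?_)
      field_simp
    have h6 : (∑ m ∈ range b, Real.exp (u * m)) * (2 * Real.sinh (u / 2)) ≤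
        (b * Real.exp (u * ((b : ℝ) - 1) / 2) * Real.exp (((b : ℝ) ^ 2 - 1) * u ^ 2 / 24)) *
          (2 * Real.sinh (u / 2)) := by
      rw [hgeom]
      have := mul_le_mul_of_nonneg_left hanti2 (Real.exp_pos (u * ((b : ℝ) - 1) / 2)).le
      linarith
    exact le_of_mul_le_mul_right h6 (by positivity)
  rcases lt_trichotomy t 0 with ht | rfl | ht
  · have h := hpos (-t) (by linarith)
    have hrefl : ∑ m ∈ range b, Real.exp (t * m) =
        Real.exp (t * ((b : ℝ) - 1)) * ∑ m ∈ range b, Real.exp (-t * m) := by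
      rw [← sum_range_reflect, mul_sum]
      refine sum_congr rfl fun m hm => ?_
      have hm' := mem_range.mp hm
      rw [← Real.exp_add, Nat.cast_sub (by omega), Nat.cast_sub hb]
      congr 1
      push_cast
      ring
    rw [hrefl]
    refine (mul_le_mul_of_nonneg_left h (Real.exp_pos _).le).trans (le_of_eq ?_)
    rw [mul_comm (b : ℝ), mul_comm (b : ℝ), ← mul_assoc, ← mul_assoc, ← Real.exp_add]
    congr 3
    · ring
    · ring
  · simp
  · exact hpos t ht

/-! ### The distribution of a sum of digits -/

/-- The number of ways to write `k` as a sum of `n` digits in base `b`, as a coefficient of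
`(1 + X + ⋯ + X^(b-1))^n`. -/
noncomputable def digitSumCount (b n k : ℕ) : ℕ :=
  ((∑ m ∈ range b, (Polynomial.X : Polynomial ℕ) ^ m) ^ n).coeff k

theorem digitSum_pow (b n : ℕ) (z : ℂ) :
    (∑ m ∈ range b, z ^ m) ^ n =
      ∑ k ∈ range (n * (b - 1) + 1), (digitSumCount b n k : ℂ) * z ^ k := by
  have hdeg : ((∑ m ∈ range b, (Polynomial.X : Polynomial ℕ) ^ m) ^ n).natDegree <
      n * (b - 1) + 1 := by
    refine Nat.lt_succ_of_le (Polynomial.natDegree_pow_le.trans ?_)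
    refine Nat.mul_le_mul_left _ (Polynomial.natDegree_sum_le_of_forall_le _ _ fun m hm => ?_)
    refine (Polynomial.natDegree_X_pow_le m).trans ?_
    have := mem_range.mp hm
    omega
  have h := Polynomial.aeval_eq_sum_range' hdeg z
  simpa [digitSumCount] using h

theorem integral_expChar_int_mul (a : ℝ) (n : ℤ) :
    ∫ x in a..a + 1, expChar (n * x) = if n = 0 then 1 else 0 := by
  split_ifs with h
  · simp [h, expChar_zero]
  · have hn : (2 * (Real.pi : ℂ) * Complex.I * n) ≠ 0 := by
      simp [h, Real.pi_ne_zero, Complex.I_ne_zero]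
    have e : ∀ x : ℝ, expChar (n * x) = Complex.exp ((2 * (Real.pi : ℂ) * Complex.I * n) * x) :=
      fun x => by
        unfold expChar
        congr 1
        push_cast
        ring
    have h1 : expChar (n * (a + 1)) = expChar (n * a) := by
      rw [mul_add, mul_one, expChar_add_int]
    rw [e, e] at h1
    simp only [e]
    rw [integral_exp_mul_complex hn, h1, sub_self, zero_div]

theorem integral_sum_mul_expChar (a : ℝ) (L k : ℕ) (hk : k < L) (c : ℕ → ℂ) :
    ∫ θ in a..a + 1, (∑ j ∈ range L, c j * expChar (θ * j)) * expChar (-(θ * k)) = c k := by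
  have e : ∀ θ : ℝ, (∑ j ∈ range L, c j * expChar (θ * j)) * expChar (-(θ * k)) =
      ∑ j ∈ range L, c j * expChar (((j : ℤ) - (k : ℤ) : ℤ) * θ) := fun θ => by
    rw [sum_mul]
    refine sum_congr rfl fun j _ => ?_
    rw [mul_assoc, ← expChar_add]
    congr 2
    push_cast
    ring
  simp only [e]
  rw [intervalIntegral.integral_finsetSum]
  · simp only [intervalIntegral.integral_const_mul, integral_expChar_int_mul]
    rw [sum_eq_single k]
    · simp
    · intro j _ hj
      rw [if_neg (by omega), mul_zero]
    · intro h
      exact absurd (mem_range.mpr hk) h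
  · intro j _
    exact (continuous_const.mul (continuous_expChar.comp (by fun_prop))).intervalIntegrable _ _

theorem digitSumCount_mul_pow_le (b n k : ℕ) (hk : k < n * (b - 1) + 1) {r : ℝ} (hr : 0 < r) :
    (digitSumCount b n k : ℝ) * r ^ k ≤
      ∫ θ in (-(1 / 2) : ℝ)..1 / 2, ‖∑ m ∈ range b, ((r ^ m : ℝ) : ℂ) * expChar (θ * m)‖ ^ n := by
  have e : ∀ θ : ℝ, (∑ m ∈ range b, ((r ^ m : ℝ) : ℂ) * expChar (θ * m)) ^ n =
      ∑ j ∈ range (n * (b - 1) + 1), ((digitSumCount b n j : ℂ) * (r : ℂ) ^ j) * expChar (θ * j) :=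
    fun θ => by
    have := digitSum_pow b n ((r : ℂ) * expChar θ)
    simp only [mul_pow, expChar_pow] at this
    simp only [Complex.ofReal_pow]
    rw [this]
    exact sum_congr rfl fun j _ => by ring
  have h := integral_sum_mul_expChar (-(1 / 2)) _ k hk
    (fun j => (digitSumCount b n j : ℂ) * (r : ℂ) ^ j)
  simp only [← e] at h
  rw [show (-(1 / 2) : ℝ) + 1 = 1 / 2 by norm_num] at h
  have h2 := intervalIntegral.norm_integral_le_integral_norm
    (f := fun θ : ℝ => (∑ m ∈ range b, ((r ^ m : ℝ) : ℂ) * expChar (θ * m)) ^ n * expChar (-(θ * k)))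
    (μ := MeasureTheory.volume) (show (-(1 / 2) : ℝ) ≤ 1 / 2 by norm_num)
  rw [h] at h2
  simp only [norm_mul, norm_pow, norm_expChar, mul_one] at h2
  rw [Complex.norm_real, Complex.norm_natCast, Real.norm_of_nonneg hr.le] at h2
  simpa using h2

/-- The tilted kernel is bounded by a Gaussian on `|θ| ≤ K^(-1/4) / b` and is exponentially small in
`√K` outside this range. -/
theorem kernel_pow_le {K b : ℕ} (hb : 2 ≤ b) (hK : 100 ≤ K) {q θ : ℝ} (hq : Real.exp (-12) ≤ q)
    (hq1 : q ≤ 1) (hθ : |θ| ≤ 1 / 2) :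
    (1 - q * (1 - (phi b θ / b) ^ 2)) ^ K ≤
      Real.exp (-(K * q * Real.pi ^ 2 * ((b : ℝ) ^ 2 - 1) / 3 * (1 - 4 / Real.sqrt K)) * θ ^ 2) +
        Real.exp (-(Real.exp (-12) / 5 * Real.sqrt K)) := by
  have hq0 : 0 < q := (Real.exp_pos _).trans_le hq
  have hb' : (2 : ℝ) ≤ b := by exact_mod_cast hb
  have hb0 : (0 : ℝ) < b := by linarith
  have hK' : (100 : ℝ) ≤ K := by exact_mod_cast hK
  have hb2 : (3 : ℝ) ≤ (b : ℝ) ^ 2 - 1 := by nlinarith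
  set x := Real.sqrt K with hx
  have hxx : x ^ 2 = K := Real.sq_sqrt (by linarith)
  have hx10 : 10 ≤ x := Real.le_sqrt_of_sq_le (by linarith)
  have hx0 : 0 < x := by linarith
  have hpisq2 : Real.pi ^ 2 < 9.93 := by nlinarith [Real.pi_gt_d2, Real.pi_lt_d2]
  have hphi1 : phi b θ / b ≤ 1 := (div_le_one hb0).mpr (phi_le b θ)
  have hphi0 : 0 ≤ phi b θ / b := div_nonneg (phi_nonneg b θ) hb0.le
  have hphisq : (phi b θ / b) ^ 2 ≤ 1 := pow_le_one₀ hphi0 hphi1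
  have hbase : 0 ≤ 1 - q * (1 - (phi b θ / b) ^ 2) := by
    nlinarith [sq_nonneg (phi b θ / b)]
  have hJ : (b : ℝ) ^ 2 * (1 - (phi b θ / b) ^ 2) = (b : ℝ) ^ 2 - phi b θ ^ 2 := by
    field_simp
  have hexp : (1 - q * (1 - (phi b θ / b) ^ 2)) ^ K ≤
      Real.exp (-(K * (q * (1 - (phi b θ / b) ^ 2)))) := by
    rw [show -(K * (q * (1 - (phi b θ / b) ^ 2))) = K * (-(q * (1 - (phi b θ / b) ^ 2))) by ring,
      Real.exp_nat_mul]
    exact pow_le_pow_left₀ hbase (Real.one_sub_le_exp_neg _) K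
  set η := Real.sqrt (1 / x) with hη
  have hηsq : η ^ 2 = 1 / x := Real.sq_sqrt (by positivity)
  have hη0 : 0 < η := Real.sqrt_pos.mpr (by positivity)
  have hx10' : 1 / x ≤ 1 / 10 := one_div_le_one_div_of_le (by norm_num) hx10
  have hη1 : η ≤ 1 / 2 := by nlinarith
  rcases le_total (b * |θ|) η with hle | hge
  · have h1 := le_sq_sub_phi_sq b θ
    rw [← hJ] at h1
    have h2 := le_of_mul_le_mul_left h1 (by positivity)
    have h3 : θ ^ 2 * (b : ℝ) ^ 2 ≤ 1 / x := by
      rw [← hηsq, ← sq_abs θ, mul_comm, ← mul_pow]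
      gcongr
    have h4 : Real.pi ^ 2 * θ ^ 2 * (b : ℝ) ^ 2 / 3 ≤ 4 / x := by
      have : Real.pi ^ 2 * (θ ^ 2 * (b : ℝ) ^ 2) ≤ 12 * (1 / x) :=
        mul_le_mul (by linarith) h3 (by positivity) (by norm_num)
      have e : 4 / x = 12 * (1 / x) / 3 := by ring
      linarith
    have h5 : Real.pi ^ 2 * θ ^ 2 * ((b : ℝ) ^ 2 - 1) / 3 * (1 - 4 / x) ≤
        1 - (phi b θ / b) ^ 2 := by
      refine le_trans (mul_le_mul_of_nonneg_left (by linarith) ?_) h2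
      have : 0 ≤ Real.pi ^ 2 * θ ^ 2 := by positivity
      have := mul_nonneg this (by linarith : 0 ≤ (b : ℝ) ^ 2 - 1)
      linarith
    have h6 : K * q * Real.pi ^ 2 * ((b : ℝ) ^ 2 - 1) / 3 * (1 - 4 / x) * θ ^ 2 ≤ K * (q * (1 - (phi b θ / b) ^ 2)) := by
      have := mul_le_mul_of_nonneg_left h5 (by positivity : (0 : ℝ) ≤ K * q)
      linarith
    have h7 : Real.exp (-(K * (q * (1 - (phi b θ / b) ^ 2)))) ≤ Real.exp (-(K * q * Real.pi ^ 2 * ((b : ℝ) ^ 2 - 1) / 3 * (1 - 4 / x)) * θ ^ 2) :=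
      Real.exp_le_exp.mpr (by linarith)
    linarith [Real.exp_pos (-(Real.exp (-12) / 5 * x))]
  · have h1 := le_sq_sub_phi_sq_of_le hb hθ hη0 hη1 hge
    rw [← hJ] at h1
    have h2 := le_of_mul_le_mul_left h1 (by positivity)
    rw [hηsq] at h2
    have h3 : Real.exp (-12) / 5 * x ≤ K * (q * (1 - (phi b θ / b) ^ 2)) := by
      have h4 : Real.exp (-12) * (1 / x / 5) ≤ q * (1 - (phi b θ / b) ^ 2) :=
        mul_le_mul hq h2 (by positivity) hq0.le
      have h5 := mul_le_mul_of_nonneg_left h4 (by positivity : (0 : ℝ) ≤ K)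
      refine le_trans (le_of_eq ?_) h5
      rw [← hxx]
      field_simp
    have h7 : Real.exp (-(K * (q * (1 - (phi b θ / b) ^ 2)))) ≤ Real.exp (-(Real.exp (-12) / 5 * x)) :=
      Real.exp_le_exp.mpr (by linarith)
    linarith [Real.exp_pos (-(K * q * Real.pi ^ 2 * ((b : ℝ) ^ 2 - 1) / 3 * (1 - 4 / x)) * θ ^ 2)]

theorem sqrt_pi_div_le {D x : ℝ} (hD0 : 0 < D) (hx10 : 10 ≤ x) :
    Real.sqrt ((1 / (1 - 4 / x)) / D) ≤ (1 + 7 / x) / Real.sqrt D := by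
  have hx0 : 0 < x := by linarith
  have h4x : 4 / x ≤ 2 / 5 := by
    rw [div_le_div_iff₀ hx0 (by norm_num)]
    linarith
  rw [Real.sqrt_div' _ hD0.le]
  gcongr
  have hpos : 0 < 1 - 4 / x := by linarith
  have h2 : 1 / (1 - 4 / x) ≤ 1 + 7 / x := by
    rw [div_le_iff₀ hpos]
    have e : (1 + 7 / x) * (1 - 4 / x) = 1 + (3 / x) - 28 / x * (1 / x) := by ring
    have h3 : 28 / x * (1 / x) ≤ 28 / x * (1 / 10) :=
      mul_le_mul_of_nonneg_left (one_div_le_one_div_of_le (by norm_num) hx10) (by positivity)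
    have e2 : 28 / x * (1 / 10) = 2.8 * (1 / x) := by ring
    have e3 : 3 / x = 3 * (1 / x) := by ring
    have : 0 < 1 / x := by positivity
    rw [e]
    linarith
  have h3 : 1 ≤ 1 + 7 / x := by
    have : 0 < 7 / x := by positivity
    linarith
  rw [Real.sqrt_le_left (by linarith)]
  nlinarith

theorem exp_neg_mul_le_div_sqrt {γ x D : ℝ} (hγ0 : 0 < γ) (hx0 : 0 < x) (hD0 : 0 < D)
    (h2 : Real.sqrt D ≤ 2 * x ^ 3) :
    Real.exp (-(γ * x)) ≤ (48 / γ ^ 4 / x) / Real.sqrt D := by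
  have h1 : Real.exp (-(γ * x)) ≤ 24 / (γ * x) ^ 4 := by
    have := Real.pow_div_factorial_le_exp (γ * x) (by positivity) 4
    rw [Real.exp_neg, ← one_div, div_le_div_iff₀ (Real.exp_pos _) (by positivity)]
    have e : ((Nat.factorial 4 : ℕ) : ℝ) = 24 := by norm_num [Nat.factorial]
    rw [e, div_le_iff₀ (by norm_num)] at this
    linarith
  refine h1.trans ?_
  rw [le_div_iff₀ (Real.sqrt_pos.mpr hD0)]
  refine (mul_le_mul_of_nonneg_left h2 (by positivity)).trans (le_of_eq ?_)
  field_simp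
  norm_num

/-- Laplace's method for the tilted kernel: up to a factor `1 + O(1/√K)` the integral is that of
the Gaussian with the same second-order term at the origin. -/
theorem exists_integral_kernel_le : ∃ C : ℝ, 0 < C ∧ ∀ K b : ℕ, 2 ≤ b → b ≤ K → 100 ≤ K →
    ∀ q : ℝ, Real.exp (-12) ≤ q → q ≤ 1 →
    ∫ θ in (-(1 / 2) : ℝ)..1 / 2, (1 - q * (1 - (phi b θ / b) ^ 2)) ^ K ≤
      (1 + C / Real.sqrt K) / Real.sqrt (2 * Real.pi * (K * ((b : ℝ) ^ 2 - 1) / 6) * q) := by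
  obtain ⟨γ, hγ⟩ : ∃ γ : ℝ, γ = Real.exp (-12) / 5 := ⟨_, rfl⟩
  have hγ0 : 0 < γ := by rw [hγ]; positivity
  refine ⟨7 + 48 / γ ^ 4, by positivity, fun K b hb hbK hK q hq hq1 => ?_⟩
  have hq0 : 0 < q := (Real.exp_pos _).trans_le hq
  have hb' : (2 : ℝ) ≤ b := by exact_mod_cast hb
  have hb0 : (0 : ℝ) < b := by linarith
  have hbK' : (b : ℝ) ≤ K := by exact_mod_cast hbK
  have hK' : (100 : ℝ) ≤ K := by exact_mod_cast hK
  have hb2 : (3 : ℝ) ≤ (b : ℝ) ^ 2 - 1 := by nlinarith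
  obtain ⟨x, hx⟩ : ∃ x : ℝ, x = Real.sqrt K := ⟨_, rfl⟩
  have hxx : x ^ 2 = K := by rw [hx]; exact Real.sq_sqrt (by linarith)
  have hx10 : 10 ≤ x := by rw [hx]; exact Real.le_sqrt_of_sq_le (by linarith)
  have hx0 : 0 < x := by linarith
  have h4x : 4 / x ≤ 2 / 5 := by
    rw [div_le_div_iff₀ hx0 (by norm_num)]
    linarith
  have hpos : 0 < 1 - 4 / x := by linarith
  obtain ⟨a, ha⟩ : ∃ a : ℝ, a = K * q * Real.pi ^ 2 * ((b : ℝ) ^ 2 - 1) / 3 * (1 - 4 / x) :=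
    ⟨_, rfl⟩
  have ha0 : 0 < a := by rw [ha]; positivity
  have hpt : ∀ θ : ℝ, |θ| ≤ 1 / 2 →
      (1 - q * (1 - (phi b θ / b) ^ 2)) ^ K ≤ Real.exp (-a * θ ^ 2) + Real.exp (-(γ * x)) := by
    intro θ hθ
    rw [ha, hγ, hx]
    exact kernel_pow_le hb hK hq hq1 hθ
  have hint : ∫ θ in (-(1 / 2) : ℝ)..1 / 2, (1 - q * (1 - (phi b θ / b) ^ 2)) ^ K ≤
      Real.sqrt (Real.pi / a) + Real.exp (-(γ * x)) := by
    have hcont : Continuous fun θ : ℝ => (1 - q * (1 - (phi b θ / b) ^ 2)) ^ K := by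
      have := continuous_phi b
      fun_prop
    have hcont2 : Continuous fun θ : ℝ => Real.exp (-a * θ ^ 2) := by fun_prop
    calc _ ≤ ∫ θ in (-(1 / 2) : ℝ)..1 / 2, (Real.exp (-a * θ ^ 2) + Real.exp (-(γ * x))) := by
          refine intervalIntegral.integral_mono_on (by norm_num) (hcont.intervalIntegrable _ _)
            ((hcont2.add continuous_const).intervalIntegrable _ _) fun θ hθ => ?_
          exact hpt θ (abs_le.mpr ⟨by linarith [hθ.1], hθ.2⟩)
      _ = (∫ θ in (-(1 / 2) : ℝ)..1 / 2, Real.exp (-a * θ ^ 2)) + Real.exp (-(γ * x)) := by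
          rw [intervalIntegral.integral_add (hcont2.intervalIntegrable _ _)
            (continuous_const.intervalIntegrable _ _), intervalIntegral.integral_const]
          norm_num
      _ ≤ _ := by
          gcongr
          rw [← integral_gaussian a, intervalIntegral.integral_of_le (by norm_num)]
          exact MeasureTheory.setIntegral_le_integral (integrable_exp_neg_mul_sq ha0)
            (Filter.Eventually.of_forall fun θ => (Real.exp_pos _).le)
  refine hint.trans ?_
  rw [← hx]
  obtain ⟨D, hD⟩ : ∃ D : ℝ, D = 2 * Real.pi * (K * ((b : ℝ) ^ 2 - 1) / 6) * q := ⟨_, rfl⟩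
  have hD0 : 0 < D := by rw [hD]; positivity
  rw [← hD]
  have h1 : Real.pi / a = (1 / (1 - 4 / x)) / D := by
    rw [ha, hD]
    field_simp
    norm_num
  have h2 : Real.sqrt D ≤ 2 * x ^ 3 := by
    rw [Real.sqrt_le_left (by positivity)]
    have h3 : (b : ℝ) ^ 2 - 1 ≤ K ^ 2 := by nlinarith
    have h4 : K * ((b : ℝ) ^ 2 - 1) / 6 ≤ K * K ^ 2 / 6 := by gcongr
    have h5 : 2 * Real.pi * (K * ((b : ℝ) ^ 2 - 1) / 6) ≤ 2 * 4 * (K * K ^ 2 / 6) :=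
      mul_le_mul (by linarith [Real.pi_le_four]) h4 (by positivity) (by norm_num)
    have h6 : D ≤ 2 * 4 * (K * K ^ 2 / 6) * 1 := by
      rw [hD]
      exact mul_le_mul h5 hq1 hq0.le (by positivity)
    have h7 : (2 * x ^ 3) ^ 2 = 4 * (K : ℝ) ^ 3 := by
      rw [← hxx]
      ring
    rw [h7]
    have : 0 < (K : ℝ) ^ 3 := by positivity
    nlinarith
  have e : (1 + (7 + 48 / γ ^ 4) / x) / Real.sqrt D =
      (1 + 7 / x) / Real.sqrt D + (48 / γ ^ 4 / x) / Real.sqrt D := by ring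
  rw [e, h1]
  exact add_le_add (sqrt_pi_div_le hD0 hx10) (exp_neg_mul_le_div_sqrt hγ0 hx0 hD0 h2)

/-- The variance of the Gaussian that dominates the distribution of a sum of `2K` digits: the
variance of that sum, slightly enlarged. -/
noncomputable def gaussVar (K b : ℕ) : ℝ :=
  K * ((b : ℝ) ^ 2 - 1) / 6 * (1 + 1 / Real.sqrt K)

/-- The exponent produced by tilting at `t = s / σ²`; the enlargement of the variance pays for the
loss `e^(|t|(b-1))` coming from the variance of the tilted digits. -/
theorem tilt_exponent_le {x v t w : ℝ} (hx : 0 < x) (hv : 0 < v) (hw : x ^ 2 * w ^ 2 ≤ 6 * v) :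
    -(t * (t * (v * (1 + 1 / x)))) + v * t ^ 2 / 2 + t * w ≤
      -((t * (v * (1 + 1 / x))) ^ 2 / (2 * (v * (1 + 1 / x)))) + 3 / x := by
  have h1 : (t * (v * (1 + 1 / x))) ^ 2 / (2 * (v * (1 + 1 / x))) = t ^ 2 * (v * (1 + 1 / x)) / 2 := by
    have : 0 < 1 + 1 / x := by positivity
    field_simp
  rw [h1]
  have h2 : 0 ≤ (v * t - x * w) ^ 2 / (2 * v * x) := by positivity
  have h3 : (v * t - x * w) ^ 2 / (2 * v * x) = v * t ^ 2 / 2 * (1 / x) - t * w + x ^ 2 * w ^ 2 / (2 * v * x) := by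
    field_simp
    ring
  have h4 : x ^ 2 * w ^ 2 / (2 * v * x) ≤ 3 / x := by
    rw [div_le_div_iff₀ (by positivity) hx]
    nlinarith
  rw [h3] at h2
  have : -(t * (t * (v * (1 + 1 / x)))) + v * t ^ 2 / 2 + t ^ 2 * (v * (1 + 1 / x)) / 2 =
    -(v * t ^ 2 / 2 * (1 / x)) := by ring
  linarith

theorem exp_three_div_le {x : ℝ} (hx10 : 10 ≤ x) : Real.exp (3 / x) ≤ 1 + 6 / x := by
  have hx0 : 0 < x := by linarith
  have h3 : 3 / x ≤ 3 / 10 := by gcongr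
  have h4 : 0 < 3 / x := by positivity
  have h5 := Real.exp_bound_div_one_sub_of_interval h4.le (by linarith)
  refine h5.trans ?_
  have h6 : 6 / x = 2 * (3 / x) := by ring
  rw [h6, div_le_iff₀ (by linarith)]
  nlinarith

theorem one_add_div_mul_le {C x : ℝ} (hC0 : 0 < C) (hx1 : 1 ≤ x) :
    (1 + C / x) * (1 + 1 / x) * (1 + 6 / x) ≤ 1 + (1 + C) * 2 * 7 / x := by
  have hx0 : 0 < x := by linarith
  obtain ⟨y, hy⟩ : ∃ y : ℝ, y = 1 / x := ⟨_, rfl⟩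
  have hy0 : 0 < y := by rw [hy]; positivity
  have hy1 : y ≤ 1 := by
    rw [hy, div_le_one hx0]
    linarith
  have e : ∀ c : ℝ, c / x = c * y := fun c => by rw [hy]; ring
  rw [e C, e 6, e ((1 + C) * 2 * 7), ← hy]
  have hy2 : y ^ 2 ≤ y := by nlinarith
  have hy3 : y ^ 3 ≤ y := by nlinarith [sq_nonneg y]
  have e2 : (1 + C * y) * (1 + y) * (1 + 6 * y) =
      1 + (C + 7) * y + (6 + 7 * C) * y ^ 2 + 6 * C * y ^ 3 := by ring
  rw [e2]
  nlinarith [mul_nonneg (by positivity : (0 : ℝ) ≤ 6 + 7 * C) (sub_nonneg.mpr hy2),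
    mul_nonneg (by positivity : (0 : ℝ) ≤ 6 * C) (sub_nonneg.mpr hy3)]

theorem norm_tilted_sum_pow_le {b : ℕ} (hb : 2 ≤ b) (t θ : ℝ) (K : ℕ) :
    ‖∑ m ∈ range b, ((Real.exp t ^ m : ℝ) : ℂ) * expChar (θ * m)‖ ^ (2 * K) ≤
      (∑ m ∈ range b, Real.exp (t * m)) ^ (2 * K) *
        (1 - ((Real.exp (|t| * ((b : ℝ) - 1)))⁻¹) ^ 2 * (1 - (phi b θ / b) ^ 2)) ^ K := by
  have hcast : ((b - 1 : ℕ) : ℝ) = (b : ℝ) - 1 := by rw [Nat.cast_sub (by omega)]; simp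
  have h := norm_sum_mul_expChar_sq_le (b := b) (by omega) (c := fun m => Real.exp (t * m))
    (ρ := Real.exp (|t| * ((b : ℝ) - 1))) (fun m _ => Real.exp_pos _) (Real.exp_pos _) (fun m hm j hj => by
      rw [← Real.exp_add]
      apply Real.exp_le_exp.mpr
      have hm' : (m : ℝ) ≤ (b : ℝ) - 1 := by
        rw [← hcast]; exact_mod_cast Nat.le_sub_one_of_lt hm
      have hj' : (j : ℝ) ≤ (b : ℝ) - 1 := by
        rw [← hcast]; exact_mod_cast Nat.le_sub_one_of_lt hj
      have h1 : |(m : ℝ) - j| ≤ (b : ℝ) - 1 := by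
        rw [abs_le]
        constructor
        · linarith [(Nat.cast_nonneg m : (0 : ℝ) ≤ m)]
        · linarith [(Nat.cast_nonneg j : (0 : ℝ) ≤ j)]
      have h2 : t * ((m : ℝ) - j) ≤ |t| * ((b : ℝ) - 1) := by
        refine (le_abs_self _).trans ?_
        rw [abs_mul]
        exact mul_le_mul_of_nonneg_left h1 (abs_nonneg t)
      linarith) θ
  have e : ∀ m : ℕ, Real.exp t ^ m = Real.exp (t * m) := fun m => by
    rw [← Real.exp_nat_mul, mul_comm]
  simp only [e]
  rw [pow_mul, pow_mul, ← mul_pow]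
  exact pow_le_pow_left₀ (by positivity) h K

/-- Uniform local limit upper bound: the number of representations of `k` as a sum of `2K` digits
is at most `1 + O(1/√K)` times a Gaussian, for every `k`. -/
theorem exists_digitSumCount_le : ∃ C : ℝ, 0 < C ∧ ∀ K b : ℕ, 2 ≤ b → b ≤ K → 100 ≤ K →
    ∀ k : ℕ, k < 2 * K * (b - 1) + 1 →
    (digitSumCount b (2 * K) k : ℝ) ≤ (b : ℝ) ^ (2 * K) * (1 + C / Real.sqrt K) /
      Real.sqrt (2 * Real.pi * gaussVar K b) *
        Real.exp (-(((k : ℝ) - K * ((b : ℝ) - 1)) ^ 2 / (2 * gaussVar K b))) := by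
  obtain ⟨C, hC0, hC⟩ := exists_integral_kernel_le
  refine ⟨(1 + C) * 2 * 7, by positivity, fun K b hb hbK hK k hk => ?_⟩
  have hb' : (2 : ℝ) ≤ b := by exact_mod_cast hb
  have hb0 : (0 : ℝ) < b := by linarith
  have hK' : (100 : ℝ) ≤ K := by exact_mod_cast hK
  have hK0 : (0 : ℝ) < K := by linarith
  have hb2 : (3 : ℝ) ≤ (b : ℝ) ^ 2 - 1 := by nlinarith
  have hbsq : K * ((b : ℝ) - 1) ^ 2 ≤ K * ((b : ℝ) ^ 2 - 1) :=
    mul_le_mul_of_nonneg_left (by nlinarith) hK0.le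
  obtain ⟨x, hx⟩ : ∃ x : ℝ, x = Real.sqrt K := ⟨_, rfl⟩
  have hxx : x ^ 2 = K := by rw [hx]; exact Real.sq_sqrt (by linarith)
  have hx10 : 10 ≤ x := by rw [hx]; exact Real.le_sqrt_of_sq_le (by linarith)
  have hx0 : 0 < x := by linarith
  obtain ⟨v, hv⟩ : ∃ v : ℝ, v = K * ((b : ℝ) ^ 2 - 1) / 6 := ⟨_, rfl⟩
  have hv0 : 0 < v := by rw [hv]; positivity
  have hσ : gaussVar K b = v * (1 + 1 / x) := by rw [gaussVar, hv, hx]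
  have hσ0 : 0 < v * (1 + 1 / x) := by positivity
  have hvσ : v ≤ v * (1 + 1 / x) := by
    have : 0 < 1 / x := by positivity
    nlinarith
  obtain ⟨s, hs⟩ : ∃ s : ℝ, s = (k : ℝ) - K * ((b : ℝ) - 1) := ⟨_, rfl⟩
  obtain ⟨t, ht⟩ : ∃ t : ℝ, t = s / (v * (1 + 1 / x)) := ⟨_, rfl⟩
  have hst : s = t * (v * (1 + 1 / x)) := by rw [ht]; field_simp
  have hcast : ((b - 1 : ℕ) : ℝ) = (b : ℝ) - 1 := by rw [Nat.cast_sub (by omega)]; simp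
  have hsabs : |s| ≤ K * ((b : ℝ) - 1) := by
    have h1 : (k : ℝ) ≤ 2 * K * ((b : ℝ) - 1) := by
      have : (k : ℝ) ≤ ((2 * K * (b - 1) : ℕ) : ℝ) := by exact_mod_cast Nat.lt_succ_iff.mp hk
      push_cast [hcast] at this
      exact this
    rw [hs, abs_le]
    constructor
    · linarith [(Nat.cast_nonneg k : (0 : ℝ) ≤ k)]
    · linarith
  have htb : |t| * ((b : ℝ) - 1) ≤ 6 := by
    rw [ht, abs_div, abs_of_pos hσ0, div_mul_eq_mul_div, div_le_iff₀ hσ0]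
    have h1 : |s| * ((b : ℝ) - 1) ≤ K * ((b : ℝ) - 1) * ((b : ℝ) - 1) :=
      mul_le_mul_of_nonneg_right hsabs (by linarith)
    have h2 : K * ((b : ℝ) - 1) * ((b : ℝ) - 1) ≤ 6 * v := by
      rw [hv]
      linarith
    linarith
  obtain ⟨w, hw⟩ : ∃ w : ℝ, w = |t| * ((b : ℝ) - 1) := ⟨_, rfl⟩
  have hw0 : 0 ≤ w := by rw [hw]; exact mul_nonneg (abs_nonneg t) (by linarith)
  rw [← hw] at htb
  -- the saving factor for the ratio `e^w` between the largest and the smallest weight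
  have hq1 : ((Real.exp w)⁻¹) ^ 2 = Real.exp (-(2 * w)) := by
    rw [← Real.exp_neg, ← Real.exp_nat_mul]
    congr 1
    push_cast
    ring
  have hqlow : Real.exp (-12) ≤ ((Real.exp w)⁻¹) ^ 2 := by
    rw [hq1]
    exact Real.exp_le_exp.mpr (by linarith)
  have hqhigh : ((Real.exp w)⁻¹) ^ 2 ≤ 1 := by
    rw [hq1]
    exact Real.exp_le_one_iff.mpr (by linarith)
  have hI := hC K b hb hbK hK _ hqlow hqhigh
  obtain ⟨Z, hZ⟩ : ∃ Z : ℝ, Z = ∑ m ∈ range b, Real.exp (t * m) := ⟨_, rfl⟩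
  have hZ0 : 0 ≤ Z := by rw [hZ]; exact sum_nonneg fun m _ => (Real.exp_pos _).le
  have hZle := sum_exp_mul_digit_le (by omega : 1 ≤ b) t
  rw [← hZ] at hZle
  have hptw : ∀ θ : ℝ, ‖∑ m ∈ range b, ((Real.exp t ^ m : ℝ) : ℂ) * expChar (θ * m)‖ ^ (2 * K) ≤
      Z ^ (2 * K) * (1 - ((Real.exp w)⁻¹) ^ 2 * (1 - (phi b θ / b) ^ 2)) ^ K := fun θ => by
    rw [hZ, hw]
    exact norm_tilted_sum_pow_le hb t θ K
  have hcount := digitSumCount_mul_pow_le b (2 * K) k hk (Real.exp_pos t)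
  have hbound : (digitSumCount b (2 * K) k : ℝ) * Real.exp t ^ k ≤ Z ^ (2 * K) *
      ((1 + C / x) / Real.sqrt (2 * Real.pi * v * ((Real.exp w)⁻¹) ^ 2)) := by
    refine hcount.trans ?_
    rw [← hv, ← hx] at hI
    refine le_trans ?_ (mul_le_mul_of_nonneg_left hI (by positivity))
    rw [← intervalIntegral.integral_const_mul]
    refine intervalIntegral.integral_mono_on (by norm_num) (Continuous.intervalIntegrable ?_ _ _)
      (Continuous.intervalIntegrable ?_ _ _) fun θ _ => hptw θ
    · exact (continuous_norm.comp (continuous_finsetSum _ fun m _ =>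
        continuous_const.mul (continuous_expChar.comp (by fun_prop)))).pow _
    · have := continuous_phi b
      fun_prop
  have hsq : Real.sqrt (2 * Real.pi * v * ((Real.exp w)⁻¹) ^ 2) =
      Real.sqrt (2 * Real.pi * v) / Real.exp w := by
    rw [Real.sqrt_mul (by positivity), Real.sqrt_sq (by positivity), div_eq_mul_inv]
  have hZpow : Z ^ (2 * K) ≤ (b : ℝ) ^ (2 * K) * Real.exp (t * (K * ((b : ℝ) - 1)) + v * t ^ 2 / 2) := by
    refine (pow_le_pow_left₀ hZ0 hZle _).trans (le_of_eq ?_)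
    rw [mul_assoc, ← Real.exp_add, mul_pow, ← Real.exp_nat_mul, hv]
    congr 2
    push_cast
    ring
  have hsqσ : Real.sqrt (2 * Real.pi * (v * (1 + 1 / x))) ≤ (1 + 1 / x) * Real.sqrt (2 * Real.pi * v) := by
    rw [← mul_assoc, Real.sqrt_mul (by positivity), mul_comm]
    refine mul_le_mul_of_nonneg_right ?_ (Real.sqrt_nonneg _)
    have : 0 < 1 / x := by positivity
    rw [Real.sqrt_le_left (by linarith)]
    nlinarith
  have hexponent : Real.exp (-(t * s) + v * t ^ 2 / 2 + w) ≤
      Real.exp (-(s ^ 2 / (2 * (v * (1 + 1 / x))))) * (1 + 6 / x) := by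
    have h1 : -(t * s) + v * t ^ 2 / 2 + w ≤ -(s ^ 2 / (2 * (v * (1 + 1 / x)))) + 3 / x := by
      have h2 := tilt_exponent_le (x := x) (v := v) (t := |t|) (w := (b : ℝ) - 1) hx0 hv0 (by
        rw [hxx, hv]
        linarith)
      rw [hst, hw]
      have e1 : |t| * |t| = t * t := abs_mul_abs_self t
      have e2 : |t| ^ 2 = t ^ 2 := sq_abs t
      rw [mul_pow, e2, ← mul_assoc, e1] at h2
      rw [mul_pow, ← mul_assoc]
      exact h2
    refine (Real.exp_le_exp.mpr h1).trans ?_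
    rw [Real.exp_add]
    exact mul_le_mul_of_nonneg_left (exp_three_div_le hx10) (Real.exp_pos _).le
  rw [hσ, ← hs, ← hx]
  have hfac := one_add_div_mul_le hC0 (by linarith : 1 ≤ x)
  obtain ⟨S, hS⟩ : ∃ S : ℝ, S = Real.sqrt (2 * Real.pi * v) := ⟨_, rfl⟩
  have hS0 : 0 < S := by rw [hS]; exact Real.sqrt_pos.mpr (by positivity)
  obtain ⟨S', hS'⟩ : ∃ S' : ℝ, S' = Real.sqrt (2 * Real.pi * (v * (1 + 1 / x))) := ⟨_, rfl⟩
  have hS'0 : 0 < S' := by rw [hS']; exact Real.sqrt_pos.mpr (by positivity)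
  rw [← hS'] at hsqσ ⊢
  rw [← hS] at hsqσ hsq
  have hSS : 1 / S ≤ (1 + 1 / x) / S' := by
    rw [div_le_div_iff₀ hS0 hS'0]
    linarith
  obtain ⟨G, hG⟩ : ∃ G : ℝ, G = Real.exp (-(s ^ 2 / (2 * (v * (1 + 1 / x))))) := ⟨_, rfl⟩
  have hG0 : 0 < G := by rw [hG]; positivity
  rw [← hG] at hexponent ⊢
  calc (digitSumCount b (2 * K) k : ℝ)
      = ((digitSumCount b (2 * K) k : ℝ) * Real.exp t ^ k) * Real.exp (-(t * k)) := by
        rw [← Real.exp_nat_mul, mul_assoc, ← Real.exp_add]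
        have : (k : ℝ) * t + -(t * k) = 0 := by ring
        rw [this, Real.exp_zero, mul_one]
    _ ≤ (((b : ℝ) ^ (2 * K) * Real.exp (t * (K * ((b : ℝ) - 1)) + v * t ^ 2 / 2)) *
          ((1 + C / x) / (S / Real.exp w))) * Real.exp (-(t * k)) := by
        refine mul_le_mul_of_nonneg_right (hbound.trans ?_) (Real.exp_pos _).le
        rw [hsq]
        exact mul_le_mul_of_nonneg_right hZpow (by positivity)
    _ = (b : ℝ) ^ (2 * K) * (1 + C / x) * (1 / S) * Real.exp (-(t * s) + v * t ^ 2 / 2 + w) := by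
        have : -(t * s) + v * t ^ 2 / 2 + w =
            (t * (K * ((b : ℝ) - 1)) + v * t ^ 2 / 2) + -(t * k) + w := by
          rw [hs]
          ring
        rw [this, Real.exp_add _ w, Real.exp_add _ (-(t * k))]
        field_simp
    _ ≤ (b : ℝ) ^ (2 * K) * (1 + C / x) * ((1 + 1 / x) / S') * (G * (1 + 6 / x)) := by
        gcongr
    _ = (b : ℝ) ^ (2 * K) / S' * G * ((1 + C / x) * (1 + 1 / x) * (1 + 6 / x)) := by ring
    _ ≤ (b : ℝ) ^ (2 * K) / S' * G * (1 + (1 + C) * 2 * 7 / x) := by gcongr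
    _ = _ := by ring

/-! ### The transfer operator of the two carries -/

/-- The number of solutions of `∑_{1 ≤ j ≤ M} s_j (b^j + b^(2M+2-j)) + U b^(2M+2) + V b = 0`, where
each `s_j` is a sum of `2K` digits shifted by its mean `K(b-1)` and is counted with multiplicity. It is
defined by peeling off `s_1`: `V` is the carry from the low end, and must make `V + s_1` divisible by
`b`, while `U` is the partial sum at the high end. -/
noncomputable def carryCount (b K : ℕ) : ℕ → ℤ → ℤ → ℝ
  | 0, U, V => if b * U + V = 0 then 1 else 0
  | M + 1, U, V => ∑ k ∈ range (2 * K * (b - 1) + 1), (digitSumCount b (2 * K) k : ℝ) *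
      (if (b : ℤ) ∣ V + ((k : ℤ) - K * (b - 1)) then
        carryCount b K M (b * U + ((k : ℤ) - K * (b - 1))) ((V + ((k : ℤ) - K * (b - 1))) / b)
      else 0)

theorem sum_exp_neg_lattice_le {ι : Type*} (I : Finset ι) (f : ι → ℤ) (hf : Set.InjOn f I) {a : ℝ}
    (ha : 0 < a) (ν : ℝ) :
    ∑ i ∈ I, Real.exp (-Real.pi / a * ((f i : ℝ) + ν) ^ 2) ≤ Real.sqrt a * (1 + 2 / a) := by
  rw [← sum_image (f := fun n : ℤ => Real.exp (-Real.pi / a * ((n : ℝ) + ν) ^ 2)) hf]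
  exact ((summable_exp_neg_mul_int_add_sq ha ν).sum_le_tsum _ fun n _ => (Real.exp_pos _).le).trans
    (tsum_exp_neg_mul_int_add_sq_le ha ν)

/-- Completing the square: the Gaussian of variance `σ²/(b²-1)` in `U` is the stationary density of
the recursion `U ↦ (U - s)/b`. -/
theorem gaussian_completion {σ b U s : ℝ} (hσ : 0 < σ) (hb : 1 < b) :
    -(s ^ 2 / (2 * σ)) - (b * U + s) ^ 2 * (b ^ 2 - 1) / (2 * σ) =
      -(U ^ 2 * (b ^ 2 - 1) / (2 * σ)) - b ^ 2 / (2 * σ) * (s + (b ^ 2 - 1) * U / b) ^ 2 := by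
  have : b ≠ 0 := by linarith
  field_simp
  ring

theorem gaussVar_pos {K b : ℕ} (hK : 1 ≤ K) (hb : 2 ≤ b) : 0 < gaussVar K b := by
  have hb' : (2 : ℝ) ≤ b := by exact_mod_cast hb
  have hK' : (1 : ℝ) ≤ K := by exact_mod_cast hK
  have : (0 : ℝ) < (b : ℝ) ^ 2 - 1 := by nlinarith
  unfold gaussVar
  positivity

theorem le_gaussVar {K b : ℕ} (hb : 2 ≤ b) :
    K * ((b : ℝ) ^ 2 - 1) / 6 ≤ gaussVar K b := by
  have hb' : (2 : ℝ) ≤ b := by exact_mod_cast hb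
  have : (0 : ℝ) < (b : ℝ) ^ 2 - 1 := by nlinarith
  unfold gaussVar
  have h2 : (0 : ℝ) ≤ 1 / Real.sqrt K := by positivity
  have h3 : (0 : ℝ) ≤ K * ((b : ℝ) ^ 2 - 1) / 6 := by positivity
  nlinarith

/-- The Gaussian is, up to a factor `1 + O(1/√K + b²/K)`, a super-eigenfunction with eigenvalue
`b^(2K-2)` of the transfer operator, uniformly in the residue class prescribed by the lower carry. -/
theorem exists_transfer_gaussian_le : ∃ C : ℝ, 0 < C ∧ ∀ K b : ℕ, 2 ≤ b → b ≤ K → 100 ≤ K →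
    ∀ U V : ℤ, ∑ k ∈ range (2 * K * (b - 1) + 1), (digitSumCount b (2 * K) k : ℝ) *
      (if (b : ℤ) ∣ V + ((k : ℤ) - K * (b - 1)) then
        Real.exp (-(((b * U + ((k : ℤ) - K * (b - 1)) : ℤ) : ℝ) ^ 2 * ((b : ℝ) ^ 2 - 1) /
          (2 * gaussVar K b)))
      else 0) ≤ (b : ℝ) ^ (2 * K) / (b : ℝ) ^ 2 *
        ((1 + C / Real.sqrt K) * (1 + C * ((b : ℝ) ^ 2 / K))) *
        Real.exp (-((U : ℝ) ^ 2 * ((b : ℝ) ^ 2 - 1) / (2 * gaussVar K b))) := by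
  obtain ⟨C, hC0, hC⟩ := exists_digitSumCount_le
  refine ⟨C + 4, by positivity, fun K b hb hbK hK U V => ?_⟩
  have hb' : (2 : ℝ) ≤ b := by exact_mod_cast hb
  have hb0 : (0 : ℝ) < b := by linarith
  have hK0 : (0 : ℝ) < K := by
    have : (100 : ℝ) ≤ K := by exact_mod_cast hK
    linarith
  have hb2 : (3 : ℝ) ≤ (b : ℝ) ^ 2 - 1 := by nlinarith
  obtain ⟨σ, hσ⟩ : ∃ σ : ℝ, σ = gaussVar K b := ⟨_, rfl⟩
  have hσ0 : 0 < σ := by rw [hσ]; exact gaussVar_pos (by omega) hb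
  have hσle : K * ((b : ℝ) ^ 2 - 1) / 6 ≤ σ := by rw [hσ]; exact le_gaussVar hb
  have hbZ : (b : ℤ) ≠ 0 := by positivity
  simp only [← hσ] at hC ⊢
  obtain ⟨P, hP⟩ : ∃ P : ℝ, P = (b : ℝ) ^ (2 * K) * (1 + C / Real.sqrt K) := ⟨_, rfl⟩
  have hP0 : 0 < P := by rw [hP]; positivity
  obtain ⟨a, ha⟩ : ∃ a : ℝ, a = 2 * Real.pi * σ / (b : ℝ) ^ 4 := ⟨_, rfl⟩
  have ha0 : 0 < a := by rw [ha]; positivity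
  obtain ⟨E, hE⟩ : ∃ E : ℝ, E = Real.exp (-((U : ℝ) ^ 2 * ((b : ℝ) ^ 2 - 1) / (2 * σ))) := ⟨_, rfl⟩
  have hE0 : 0 < E := by rw [hE]; positivity
  rw [← hE]
  obtain ⟨ν, hν⟩ : ∃ ν : ℝ, ν = -(V : ℝ) / b + ((b : ℝ) ^ 2 - 1) * U / (b : ℝ) ^ 2 := ⟨_, rfl⟩
  have hterm : ∀ k ∈ range (2 * K * (b - 1) + 1), (digitSumCount b (2 * K) k : ℝ) *
      (if (b : ℤ) ∣ V + ((k : ℤ) - K * (b - 1)) then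
        Real.exp (-(((b * U + ((k : ℤ) - K * (b - 1)) : ℤ) : ℝ) ^ 2 * ((b : ℝ) ^ 2 - 1) / (2 * σ)))
      else 0) ≤ if (b : ℤ) ∣ V + ((k : ℤ) - K * (b - 1)) then
        P / Real.sqrt (2 * Real.pi * σ) * E * Real.exp (-Real.pi / a *
          ((((V + ((k : ℤ) - K * (b - 1))) / b : ℤ) : ℝ) + ν) ^ 2) else 0 := by
    intro k hk
    split_ifs with hdvd
    · obtain ⟨j, hj⟩ := hdvd
      rw [hj, Int.mul_ediv_cancel_left _ hbZ]
      have hs : ((k : ℝ) - K * ((b : ℝ) - 1)) = b * j - V := by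
        have := congrArg (Int.cast : ℤ → ℝ) hj
        push_cast at this
        linarith
      have h1 := hC K b hb hbK hK k (mem_range.mp hk)
      rw [← hσ, ← hP] at h1
      refine (mul_le_mul_of_nonneg_right h1 (Real.exp_pos _).le).trans (le_of_eq ?_)
      push_cast
      rw [hs, mul_assoc (P / _), mul_assoc (P / _), ← Real.exp_add, hE, ← Real.exp_add]
      congr 2
      have h2 := gaussian_completion (σ := σ) (b := b) (U := U) (s := b * j - V) hσ0 (by linarith)
      rw [sub_eq_add_neg] at h2
      rw [h2, sub_eq_add_neg]
      congr 1
      rw [ha, hν]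
      field_simp
      ring
    · simp
  refine (sum_le_sum hterm).trans ?_
  rw [← sum_filter, ← mul_sum]
  have hlat := sum_exp_neg_lattice_le
    ((range (2 * K * (b - 1) + 1)).filter fun k : ℕ => (b : ℤ) ∣ V + ((k : ℤ) - K * (b - 1)))
    (fun k : ℕ => (V + ((k : ℤ) - K * (b - 1))) / b) (by
      intro k hk l hl hkl
      simp only [coe_filter, Set.mem_ofPred_eq] at hk hl hkl
      have h1 := Int.ediv_left_inj hk.2 hl.2 |>.mp hkl
      omega) ha0 ν
  have hinv : 2 / a ≤ (C + 4) * ((b : ℝ) ^ 2 / K) := by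
    have h1 : K * (b : ℝ) ^ 2 / 8 ≤ σ := by
      refine le_trans ?_ hσle
      have : K * (b : ℝ) ^ 2 * 3 ≤ 4 * (K * ((b : ℝ) ^ 2 - 1)) := by nlinarith
      linarith
    have h2 : K / (2 * (b : ℝ) ^ 2) ≤ a := by
      rw [ha, div_le_div_iff₀ (by positivity) (by positivity)]
      have h3 : 4 * σ ≤ 2 * Real.pi * σ := by nlinarith [Real.pi_gt_three]
      have h4 : K * (b : ℝ) ^ 2 / 2 * (2 * (b : ℝ) ^ 2) ≤ 2 * Real.pi * σ * (2 * (b : ℝ) ^ 2) :=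
        mul_le_mul_of_nonneg_right (by linarith) (by positivity)
      refine le_trans (le_of_eq ?_) h4
      ring
    calc 2 / a ≤ 2 / (K / (2 * (b : ℝ) ^ 2)) := by gcongr
      _ = 4 * ((b : ℝ) ^ 2 / K) := by field_simp; norm_num
      _ ≤ _ := by
        have : 0 ≤ (b : ℝ) ^ 2 / K := by positivity
        nlinarith
  have hsqrt : Real.sqrt a = Real.sqrt (2 * Real.pi * σ) / (b : ℝ) ^ 2 := by
    rw [ha, Real.sqrt_div' _ (by positivity), show (b : ℝ) ^ 4 = ((b : ℝ) ^ 2) ^ 2 by ring,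
      Real.sqrt_sq (by positivity)]
  obtain ⟨S, hS⟩ : ∃ S : ℝ, S = Real.sqrt (2 * Real.pi * σ) := ⟨_, rfl⟩
  have hS0 : 0 < S := by rw [hS]; exact Real.sqrt_pos.mpr (by positivity)
  rw [← hS] at hsqrt ⊢
  refine (mul_le_mul_of_nonneg_left hlat (by positivity)).trans ?_
  rw [hsqrt]
  calc P / S * E * (S / (b : ℝ) ^ 2 * (1 + 2 / a))
      = (b : ℝ) ^ (2 * K) / (b : ℝ) ^ 2 * ((1 + C / Real.sqrt K) * (1 + 2 / a)) * E := by
        rw [hP]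
        field_simp
    _ ≤ _ := by
        gcongr
        linarith

/-- Iterating the transfer operator. The hypothesis `|V| ≤ K` is preserved from step to step, and it
confines `U` at the end, where the Gaussian is compared with the condition `b U + V = 0`. -/
theorem exists_carryCount_le : ∃ C : ℝ, 0 < C ∧ ∀ K b : ℕ, 2 ≤ b → b ≤ K → 100 ≤ K →
    ∀ (M : ℕ) (U V : ℤ), |V| ≤ K →
    carryCount b K M U V ≤ Real.exp (3 * K / (b : ℝ) ^ 2) * ((b : ℝ) ^ (2 * K) / (b : ℝ) ^ 2 *
        ((1 + C / Real.sqrt K) * (1 + C * ((b : ℝ) ^ 2 / K)))) ^ M *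
        Real.exp (-((U : ℝ) ^ 2 * ((b : ℝ) ^ 2 - 1) / (2 * gaussVar K b))) := by
  obtain ⟨C, hC0, hC⟩ := exists_transfer_gaussian_le
  refine ⟨C, hC0, fun K b hb hbK hK M => ?_⟩
  have hb' : (2 : ℝ) ≤ b := by exact_mod_cast hb
  have hb0 : (0 : ℝ) < b := by linarith
  have hK0 : (0 : ℝ) < K := by
    have : (100 : ℝ) ≤ K := by exact_mod_cast hK
    linarith
  have hb2 : (3 : ℝ) ≤ (b : ℝ) ^ 2 - 1 := by nlinarith
  have hbZ : (0 : ℤ) < b := by positivity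
  have hσ0 : 0 < gaussVar K b := gaussVar_pos (by omega) hb
  have hσle : K * ((b : ℝ) ^ 2 - 1) / 6 ≤ gaussVar K b := le_gaussVar hb
  induction M with
  | zero =>
    intro U V hV
    rw [carryCount, pow_zero, mul_one, ← Real.exp_add]
    split_ifs with h
    · apply Real.one_le_exp
      -- the last condition forces `|U| ≤ K / b`
      have h1 : (U : ℝ) ^ 2 * (b : ℝ) ^ 2 ≤ (K : ℝ) ^ 2 := by
        have h2 : ((b : ℝ) * U) = -V := by
          have := congrArg (Int.cast : ℤ → ℝ) h
          push_cast at this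
          linarith
        have h3 : |(V : ℝ)| ≤ K := by exact_mod_cast hV
        calc (U : ℝ) ^ 2 * (b : ℝ) ^ 2 = |(V : ℝ)| ^ 2 := by
              rw [sq_abs, show (V : ℝ) = -(b * U) by linarith]
              ring
          _ ≤ _ := pow_le_pow_left₀ (abs_nonneg _) h3 2
      have h4 : (U : ℝ) ^ 2 * ((b : ℝ) ^ 2 - 1) / (2 * gaussVar K b) ≤ 3 * K / (b : ℝ) ^ 2 := by
        rw [div_le_div_iff₀ (by positivity) (by positivity)]
        calc (U : ℝ) ^ 2 * ((b : ℝ) ^ 2 - 1) * (b : ℝ) ^ 2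
            = ((U : ℝ) ^ 2 * (b : ℝ) ^ 2) * ((b : ℝ) ^ 2 - 1) := by ring
          _ ≤ (K : ℝ) ^ 2 * ((b : ℝ) ^ 2 - 1) := by gcongr
          _ = 3 * K * (2 * (K * ((b : ℝ) ^ 2 - 1) / 6)) := by ring
          _ ≤ _ := by gcongr
      linarith
    · positivity
  | succ M ih =>
    intro U V hV
    rw [carryCount]
    have hterm : ∀ k ∈ range (2 * K * (b - 1) + 1), (digitSumCount b (2 * K) k : ℝ) *
      (if (b : ℤ) ∣ V + ((k : ℤ) - K * (b - 1)) then
        carryCount b K M (b * U + ((k : ℤ) - K * (b - 1))) ((V + ((k : ℤ) - K * (b - 1))) / b)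
      else 0) ≤ Real.exp (3 * K / (b : ℝ) ^ 2) * ((b : ℝ) ^ (2 * K) / (b : ℝ) ^ 2 *
        ((1 + C / Real.sqrt K) * (1 + C * ((b : ℝ) ^ 2 / K)))) ^ M *
        ((digitSumCount b (2 * K) k : ℝ) * (if (b : ℤ) ∣ V + ((k : ℤ) - K * (b - 1)) then
        Real.exp (-(((b * U + ((k : ℤ) - K * (b - 1)) : ℤ) : ℝ) ^ 2 * ((b : ℝ) ^ 2 - 1) /
          (2 * gaussVar K b)))
      else 0)) := by
      intro k hk
      split_ifs with hdvd
      · rw [mul_left_comm]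
        refine mul_le_mul_of_nonneg_left (ih _ _ ?_) (Nat.cast_nonneg _)
        obtain ⟨j, hj⟩ := hdvd
        rw [hj, Int.mul_ediv_cancel_left _ hbZ.ne']
        have hk' : (k : ℤ) ≤ 2 * K * (b - 1) := by
          have h1 : (k : ℤ) ≤ ((2 * K * (b - 1) : ℕ) : ℤ) := by
            exact_mod_cast Nat.lt_succ_iff.mp (mem_range.mp hk)
          push_cast [Nat.cast_sub (by omega : 1 ≤ b)] at h1
          exact h1
        have hk0 : (0 : ℤ) ≤ k := by positivity
        rw [abs_le] at hV ⊢
        constructor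
        · refine le_of_mul_le_mul_left ?_ hbZ
          rw [← hj]
          linarith [hV.1]
        · refine le_of_mul_le_mul_left ?_ hbZ
          rw [← hj]
          linarith [hV.2]
      · simp
    refine (sum_le_sum hterm).trans ?_
    rw [← mul_sum]
    refine (mul_le_mul_of_nonneg_left (hC K b hb hbK hK U V) (by positivity)).trans (le_of_eq ?_)
    rw [pow_succ]
    ring

theorem ofReal_phi_pow {b : ℕ} (hb : 1 ≤ b) (K : ℕ) (θ : ℝ) :
    ((phi b θ ^ (2 * K) : ℝ) : ℂ) = ∑ k ∈ range (2 * K * (b - 1) + 1),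
      (digitSumCount b (2 * K) k : ℂ) * expChar (θ * (((k : ℤ) - K * (b - 1) : ℤ) : ℝ)) := by
  have hS : ∑ m ∈ range b, expChar (θ * m) = ∑ m ∈ range b, expChar θ ^ m :=
    sum_congr rfl fun m _ => (expChar_pow θ m).symm
  -- reversing the digits shows that the conjugate of the digit sum is a phase times the sum
  have hconj : (starRingEnd ℂ) (∑ m ∈ range b, expChar (θ * m)) =
      expChar (-(θ * ((b : ℝ) - 1))) * ∑ m ∈ range b, expChar (θ * m) := by
    rw [map_sum, ← sum_range_reflect, mul_sum]
    refine sum_congr rfl fun m hm => ?_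
    have hm' := mem_range.mp hm
    rw [conj_expChar, ← expChar_add, Nat.cast_sub (by omega), Nat.cast_sub hb]
    congr 1
    push_cast
    ring
  have h1 : ((phi b θ ^ (2 * K) : ℝ) : ℂ) = (∑ m ∈ range b, expChar θ ^ m) ^ (2 * K) *
      expChar (-(θ * ((b : ℝ) - 1)) * K) := by
    rw [pow_mul, Complex.ofReal_pow, Complex.ofReal_pow, phi, ← Complex.mul_conj', hconj, hS,
      ← expChar_pow, pow_mul, ← mul_pow]
    ring
  rw [h1, digitSum_pow, sum_mul]
  refine sum_congr rfl fun k _ => ?_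
  rw [mul_assoc, expChar_pow, ← expChar_add]
  congr 2
  push_cast
  ring

theorem continuous_bigPhi (b N : ℕ) : Continuous (bigPhi b N) := by
  unfold bigPhi
  exact continuous_finsetProd _ fun n _ => (continuous_phi b).comp (by fun_prop)

theorem bigPhi_nonneg (b N : ℕ) (α : ℝ) : 0 ≤ bigPhi b N α :=
  prod_nonneg fun _ _ => phi_nonneg _ _

theorem bigPhi_le (b N : ℕ) (α : ℝ) : bigPhi b N α ≤ (b : ℝ) ^ (N - 1) := by
  unfold bigPhi
  refine (prod_le_prod (fun _ _ => phi_nonneg _ _) fun n _ => phi_le b _).trans ?_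
  simp

theorem bigPhi_add_div {b : ℕ} (hb : 1 ≤ b) (N : ℕ) (α : ℝ) (z : ℤ) :
    bigPhi b N (α + z / b) = bigPhi b N α := by
  have hb0 : (b : ℝ) ≠ 0 := by positivity
  unfold bigPhi
  refine prod_congr rfl fun n hn => ?_
  rw [mem_Ico] at hn
  obtain ⟨n', rfl⟩ : ∃ n', n = n' + 1 := ⟨n - 1, by omega⟩
  obtain ⟨l, hl⟩ : ∃ l, 2 * N - (n' + 1) = l + 1 := ⟨2 * N - (n' + 1) - 1, by omega⟩
  rw [hl]
  have e : (α + z / b) * ((b : ℝ) ^ (n' + 1) + (b : ℝ) ^ (l + 1)) =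
      α * ((b : ℝ) ^ (n' + 1) + (b : ℝ) ^ (l + 1)) + ((z * ((b : ℤ) ^ n' + (b : ℤ) ^ l) : ℤ) : ℝ) := by
    push_cast
    field_simp
    ring
  rw [e, phi_add_int]

theorem bigPhi_periodic {b : ℕ} (hb : 1 ≤ b) (N : ℕ) : Function.Periodic (bigPhi b N) 1 := by
  intro α
  have hb0 : (b : ℝ) ≠ 0 := by positivity
  have := bigPhi_add_div hb N α b
  rwa [Int.cast_natCast, div_self hb0] at this

theorem bigPhi_succ_succ (b M : ℕ) (α : ℝ) : bigPhi b (M + 2) α =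
    phi b (α * ((b : ℝ) + (b : ℝ) ^ (2 * M + 3))) * bigPhi b (M + 1) (α * b) := by
  unfold bigPhi
  rw [prod_eq_prod_Ico_succ_bot (by omega)]
  congr 1
  · rw [pow_one]
    congr 4
  · rw [← prod_Ico_add' _ 1 (M + 1) 1]
    refine prod_congr rfl fun n hn => ?_
    rw [mem_Ico] at hn
    have e : 2 * (M + 2) - (n + 1) = (2 * (M + 1) - n) + 1 := by omega
    rw [e, pow_succ, pow_succ]
    congr 1
    ring

theorem integral_comp_mul_nat_of_periodic {f : ℝ → ℂ} (hf : Function.Periodic f 1)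
    (hc : Continuous f) {b : ℕ} (hb : 1 ≤ b) : ∫ x in (0 : ℝ)..1, f (x * b) = ∫ x in (0 : ℝ)..1, f x := by
  have hb0 : (b : ℝ) ≠ 0 := by positivity
  rw [intervalIntegral.integral_comp_mul_right _ hb0]
  have h := hf.intervalIntegral_add_zsmul_eq b 0
  simp only [zero_add, zsmul_eq_mul, Int.cast_natCast, mul_one, zero_mul, one_mul] at h ⊢
  rw [h fun _ _ => hc.intervalIntegrable _ _, Complex.real_smul]
  push_cast
  have hb1 : (b : ℂ) ≠ 0 := by exact_mod_cast hb0
  field_simp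

theorem int_dvd_of_expChar_div_eq_one {b : ℕ} (hb : 1 ≤ b) {Y : ℤ}
    (h : expChar ((Y : ℝ) / b) = 1) : (b : ℤ) ∣ Y := by
  unfold expChar at h
  rw [Complex.exp_eq_one_iff] at h
  obtain ⟨n, hn⟩ := h
  have hpi := Complex.two_pi_I_ne_zero
  rw [mul_comm (n : ℂ)] at hn
  have h1 := mul_left_cancel₀ hpi hn
  have hb0 : (b : ℂ) ≠ 0 := by exact_mod_cast (by omega : b ≠ 0)
  push_cast at h1
  rw [div_eq_iff hb0] at h1
  refine ⟨n, ?_⟩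
  have : (Y : ℂ) = ((b * n : ℤ) : ℂ) := by
    push_cast
    rw [h1]
    ring
  exact_mod_cast this

theorem integral_bigPhi_mul_expChar {b : ℕ} (hb : 1 ≤ b) (K M : ℕ) (U V : ℤ) :
    ∫ α in (0 : ℝ)..1, ((bigPhi b (M + 1) α ^ (2 * K) : ℝ) : ℂ) *
      expChar (α * ((U * (b : ℤ) ^ (2 * M + 2) + V * b : ℤ) : ℝ)) = (carryCount b K M U V : ℂ) := by
  have hb0 : (b : ℝ) ≠ 0 := by positivity
  have hbZ : (b : ℤ) ≠ 0 := by positivity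
  induction M generalizing U V with
  | zero =>
    have h := integral_expChar_int_mul 0 (U * (b : ℤ) ^ 2 + V * b)
    simp only [zero_add] at h
    have h1 : ∀ α : ℝ, ((bigPhi b (0 + 1) α ^ (2 * K) : ℝ) : ℂ) = 1 := fun α => by simp [bigPhi]
    simp only [h1, one_mul, mul_comm _ ((_ : ℤ) : ℝ)]
    rw [show 2 * 0 + 2 = 2 by norm_num, h, carryCount]
    have hiff : U * (b : ℤ) ^ 2 + V * b = 0 ↔ b * U + V = 0 := by
      rw [show U * (b : ℤ) ^ 2 + V * b = b * (b * U + V) by ring, mul_eq_zero, or_iff_right hbZ]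
    simp only [hiff]
    split_ifs <;> simp
  | succ M ih =>
    -- after peeling off the outermost factor the integrand is a function of `b α`
    obtain ⟨f, hf⟩ : ∃ f : ℤ → ℤ → ℝ → ℂ, f = fun W Y β =>
        ((bigPhi b (M + 1) β ^ (2 * K) : ℝ) : ℂ) *
          expChar (β * ((W * (b : ℤ) ^ (2 * M + 2) + Y : ℤ) : ℝ)) := ⟨_, rfl⟩
    have hfcont : ∀ W Y, Continuous (f W Y) := fun W Y => by
      rw [hf]
      exact (Complex.continuous_ofReal.comp ((continuous_bigPhi b _).pow _)).mul
        (continuous_expChar.comp (by fun_prop))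
    have hfper : ∀ W Y, Function.Periodic (f W Y) 1 := fun W Y β => by
      simp only [hf]
      rw [bigPhi_periodic hb, add_mul, one_mul, expChar_add_int]
    have hfshift : ∀ W Y β, f W Y (β + 1 / b) = f W Y β * expChar ((Y : ℝ) / b) := fun W Y β => by
      simp only [hf]
      have h1 := bigPhi_add_div hb (M + 1) β 1
      rw [Int.cast_one] at h1
      rw [h1, mul_assoc, ← expChar_add]
      have e : (β + 1 / b) * ((W * (b : ℤ) ^ (2 * M + 2) + Y : ℤ) : ℝ) =
          β * ((W * (b : ℤ) ^ (2 * M + 2) + Y : ℤ) : ℝ) + (Y : ℝ) / b +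
            ((W * (b : ℤ) ^ (2 * M + 1) : ℤ) : ℝ) := by
        push_cast
        field_simp
        ring
      rw [e, expChar_add_int]
    have hfint : ∀ W Y, ∫ β in (0 : ℝ)..1, f W Y β =
        if (b : ℤ) ∣ Y then (carryCount b K M W (Y / b) : ℂ) else 0 := fun W Y => by
      split_ifs with hdvd
      · obtain ⟨j, rfl⟩ := hdvd
        rw [Int.mul_ediv_cancel_left _ hbZ, ← ih, mul_comm (b : ℤ) j, hf]
      · have h1 := (hfper W Y).intervalIntegral_add_eq (1 / b) 0
        have h2 : ∫ β in (0 : ℝ)..1, f W Y (β + 1 / b) = ∫ β in (0 : ℝ)..1, f W Y β := by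
          rw [intervalIntegral.integral_comp_add_right]
          rw [zero_add] at h1 ⊢
          rw [← h1, add_comm]
        simp only [hfshift, intervalIntegral.integral_mul_const] at h2
        have h3 : (∫ β in (0 : ℝ)..1, f W Y β) * (expChar ((Y : ℝ) / b) - 1) = 0 := by
          rw [mul_sub, h2]
          ring
        rcases mul_eq_zero.mp h3 with h | h
        · exact h
        · exact absurd (int_dvd_of_expChar_div_eq_one hb (sub_eq_zero.mp h)) hdvd
    have hexp : ∀ α : ℝ, ((bigPhi b (M + 1 + 1) α ^ (2 * K) : ℝ) : ℂ) *
        expChar (α * ((U * (b : ℤ) ^ (2 * (M + 1) + 2) + V * b : ℤ) : ℝ)) =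
        ∑ k ∈ range (2 * K * (b - 1) + 1), (digitSumCount b (2 * K) k : ℂ) *
          f (b * U + ((k : ℤ) - K * (b - 1))) (V + ((k : ℤ) - K * (b - 1))) (α * b) := fun α => by
      rw [show M + 1 + 1 = M + 2 by ring, bigPhi_succ_succ, mul_pow, Complex.ofReal_mul,
        ofReal_phi_pow hb, sum_mul, sum_mul]
      refine sum_congr rfl fun k _ => ?_
      simp only [hf]
      rw [mul_assoc, mul_assoc, mul_left_comm (expChar _), ← expChar_add]
      congr 3
      push_cast
      ring
    simp only [hexp]
    rw [intervalIntegral.integral_finsetSum, carryCount]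
    · push_cast
      refine sum_congr rfl fun k _ => ?_
      rw [intervalIntegral.integral_const_mul,
        integral_comp_mul_nat_of_periodic (hfper _ _) (hfcont _ _) hb, hfint]
      split_ifs <;> simp
    · intro k _
      exact (continuous_const.mul ((hfcont _ _).comp (by fun_prop))).intervalIntegrable _ _

theorem integral_bigPhi_pow {b : ℕ} (hb : 1 ≤ b) (K M : ℕ) :
    ∫ α in (0 : ℝ)..1, bigPhi b (M + 1) α ^ (2 * K) = carryCount b K M 0 0 := by
  have h := integral_bigPhi_mul_expChar hb K M 0 0
  simp only [zero_mul, add_zero, Int.cast_zero, mul_zero, expChar_zero, mul_one] at h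
  rw [intervalIntegral.integral_ofReal] at h
  exact_mod_cast h

/-! ### A large sieve inequality -/

theorem distNearestInt_le (x : ℝ) (z : ℤ) : distNearestInt x ≤ |x - z| := round_le x z

/-- The `δ/2`-neighbourhoods modulo `1` of `δ`-spaced points are disjoint. -/
theorem sum_integral_le_of_spaced {ι : Type*} (I : Finset ι) (x : ι → ℝ) {δ : ℝ} (hδ0 : 0 < δ)
    (hδ1 : δ ≤ 1) (hx : ∀ i ∈ I, ∀ j ∈ I, i ≠ j → δ ≤ distNearestInt (x i - x j)) {H : ℝ → ℝ}
    (hper : Function.Periodic H 1) (hcont : Continuous H) (hH : ∀ t, 0 ≤ H t) :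
    ∑ i ∈ I, ∫ t in (x i - δ / 2)..(x i + δ / 2), H t ≤ ∫ t in (0 : ℝ)..1, H t := by
  obtain ⟨A, hA⟩ : ∃ A : ι → Set ℝ, A = fun i => ⋃ z : ℤ, Metric.ball (x i + z) (δ / 2) := ⟨_, rfl⟩
  have hmem : ∀ i t, t ∈ A i ↔ ∃ z : ℤ, |t - (x i + z)| < δ / 2 := fun i t => by
    simp [hA, Real.dist_eq]
  have hmeas : ∀ i, MeasurableSet (A i) := fun i => by
    rw [hA]
    exact (isOpen_iUnion fun z => Metric.isOpen_ball).measurableSet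
  have hdisj : Set.PairwiseDisjoint (I : Set ι) fun i => Set.Ioc (0 : ℝ) 1 ∩ A i := by
    intro i hi j hj hij
    rw [Function.onFun, Set.disjoint_left]
    rintro t ⟨_, ht⟩ ⟨_, ht'⟩
    obtain ⟨z, hz⟩ := (hmem i t).mp ht
    obtain ⟨w, hw⟩ := (hmem j t).mp ht'
    have h1 := hx i hi j hj hij
    have h2 := distNearestInt_le (x i - x j) (w - z)
    rw [abs_lt] at hz hw
    have h3 : |x i - x j - ((w - z : ℤ) : ℝ)| < δ := by
      push_cast
      rw [abs_lt]
      constructor <;> linarith [hz.1, hz.2, hw.1, hw.2]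
    linarith
  have hint : ∀ s : Set ℝ, s ⊆ Set.Ioc 0 1 → MeasureTheory.IntegrableOn H s := fun s hs =>
    (hcont.integrableOn_Ioc).mono_set hs
  have hone : ∀ i, ∫ t in (x i - δ / 2)..(x i + δ / 2), H t ≤
      ∫ t in Set.Ioc (0 : ℝ) 1 ∩ A i, H t := fun i => by
    have hindper : Function.Periodic ((A i).indicator H) 1 := fun t => by
      have : t + 1 ∈ A i ↔ t ∈ A i := by
        rw [hmem, hmem]
        constructor
        · rintro ⟨z, hz⟩
          refine ⟨z - 1, ?_⟩
          push_cast
          convert hz using 2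
          ring
        · rintro ⟨z, hz⟩
          refine ⟨z + 1, ?_⟩
          push_cast
          convert hz using 2
          ring
      by_cases h : t ∈ A i
      · rw [Set.indicator_of_mem h, Set.indicator_of_mem (this.mpr h), hper]
      · rw [Set.indicator_of_notMem h, Set.indicator_of_notMem (this.not.mpr h)]
    have h1 := hindper.intervalIntegral_add_eq (x i - 1 / 2) 0
    rw [intervalIntegral.integral_of_le (by linarith), intervalIntegral.integral_of_le (by linarith),
      zero_add, MeasureTheory.setIntegral_indicator (hmeas i),
      MeasureTheory.setIntegral_indicator (hmeas i)] at h1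
    rw [← h1, intervalIntegral.integral_of_le (by linarith),
      MeasureTheory.integral_Ioc_eq_integral_Ioo]
    refine MeasureTheory.setIntegral_mono_set ((hcont.integrableOn_Ioc).mono_set Set.inter_subset_left)
      (Filter.Eventually.of_forall hH) (Filter.Eventually.of_forall ?_)
    intro t ht
    refine ⟨⟨by linarith [ht.1], by linarith [ht.2]⟩, (hmem i t).mpr ⟨0, ?_⟩⟩
    rw [abs_lt]
    push_cast
    constructor <;> linarith [ht.1, ht.2]
  refine (sum_le_sum fun i _ => hone i).trans ?_
  rw [← MeasureTheory.integral_biUnion_finset I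
    (fun i _ => measurableSet_Ioc.inter (hmeas i)) hdisj (fun i _ => hint _ Set.inter_subset_left),
    intervalIntegral.integral_of_le zero_le_one]
  exact MeasureTheory.setIntegral_mono_set (hint _ le_rfl) (Filter.Eventually.of_forall hH)
    (Filter.Eventually.of_forall (Set.iUnion₂_subset fun i _ => Set.inter_subset_left))

theorem card_le_inv_of_spaced {ι : Type*} (I : Finset ι) (x : ι → ℝ) {δ : ℝ} (hδ0 : 0 < δ)
    (hδ1 : δ ≤ 1) (hx : ∀ i ∈ I, ∀ j ∈ I, i ≠ j → δ ≤ distNearestInt (x i - x j)) :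
    (#I : ℝ) ≤ δ⁻¹ := by
  have h := sum_integral_le_of_spaced I x hδ0 hδ1 hx (H := fun _ => 1) (fun _ => rfl)
    continuous_const (fun _ => zero_le_one)
  have e : ∀ i, x i + δ / 2 - (x i - δ / 2) = δ := fun i => by ring
  simp only [intervalIntegral.integral_const, smul_eq_mul, mul_one, e, sum_const, nsmul_eq_mul] at h
  rw [← one_div, le_div_iff₀ hδ0]
  linarith

/-- The value of `F` at `x` is at most its mean over the interval of length `δ` centred at `x` plus
the variation of `F` there. -/
theorem le_integral_of_abs_deriv_le {F F' G : ℝ → ℝ} (hF : ∀ t, HasDerivAt F (F' t) t)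
    (hF' : Continuous F') (hG : Continuous G) (hFG : ∀ t, |F' t| ≤ G t) (x : ℝ) {δ : ℝ}
    (hδ : 0 < δ) :
    F x ≤ ∫ t in (x - δ / 2)..(x + δ / 2), (δ⁻¹ * F t + G t) := by
  have hFc : Continuous F := continuous_iff_continuousAt.mpr fun t => (hF t).continuousAt
  have hG0 : ∀ t, 0 ≤ G t := fun t => (abs_nonneg _).trans (hFG t)
  have hab : x - δ / 2 ≤ x + δ / 2 := by linarith
  obtain ⟨J, hJ⟩ : ∃ J : ℝ, J = ∫ t in (x - δ / 2)..(x + δ / 2), G t := ⟨_, rfl⟩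
  have hpt : ∀ y ∈ Set.Icc (x - δ / 2) (x + δ / 2), F x ≤ F y + J := by
    intro y hy
    have h1 : ∫ t in y..x, F' t = F x - F y :=
      intervalIntegral.integral_eq_sub_of_hasDerivAt (fun t _ => hF t) (hF'.intervalIntegrable _ _)
    have h2 : ‖∫ t in y..x, F' t‖ ≤ |∫ t in y..x, G t| :=
      intervalIntegral.norm_integral_le_abs_of_norm_le
        (Filter.Eventually.of_forall fun t => hFG t) (hG.intervalIntegrable _ _)
    have h3 : |∫ t in y..x, G t| ≤ |∫ t in (x - δ / 2)..(x + δ / 2), G t| := by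
      refine intervalIntegral.abs_integral_mono_interval ?_ (Filter.Eventually.of_forall hG0)
        (hG.intervalIntegrable _ _)
      rw [Set.uIoc_of_le hab]
      intro t ht
      rw [Set.mem_uIoc] at ht
      rcases ht with ht | ht
      · exact ⟨by linarith [hy.1, ht.1], by linarith [ht.2]⟩
      · exact ⟨by linarith [ht.1], by linarith [hy.2, ht.2]⟩
    have hJ0 : 0 ≤ J := by rw [hJ]; exact intervalIntegral.integral_nonneg hab fun t _ => hG0 t
    rw [← hJ, abs_of_nonneg hJ0] at h3
    rw [h1, Real.norm_eq_abs] at h2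
    linarith [le_abs_self (F x - F y)]
  have hmean : δ * F x ≤ (∫ t in (x - δ / 2)..(x + δ / 2), F t) + δ * J := by
    have h := intervalIntegral.integral_mono_on (μ := MeasureTheory.volume) hab (f := fun _ => F x) (g := fun t => F t + J)
      (continuous_const.intervalIntegrable _ _)
      ((hFc.add continuous_const).intervalIntegrable _ _) hpt
    rw [intervalIntegral.integral_add (hFc.intervalIntegrable _ _)
      (continuous_const.intervalIntegrable _ _), intervalIntegral.integral_const,
      intervalIntegral.integral_const, show x + δ / 2 - (x - δ / 2) = δ by ring] at h
    simpa using h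
  have hFc2 : Continuous fun t => δ⁻¹ * F t := continuous_const.mul hFc
  rw [intervalIntegral.integral_add (hFc2.intervalIntegrable _ _)
    (hG.intervalIntegrable _ _), intervalIntegral.integral_const_mul, ← hJ]
  have h2 := mul_le_mul_of_nonneg_left hmean (inv_pos.mpr hδ).le
  rw [mul_add, inv_mul_cancel_left₀ hδ.ne', inv_mul_cancel_left₀ hδ.ne'] at h2
  exact h2

theorem integral_norm_sum_expChar_sq (L : ℕ) (c : ℕ → ℂ) :
    ∫ θ in (0 : ℝ)..1, ‖∑ k ∈ range L, c k * expChar (θ * k)‖ ^ 2 = ∑ k ∈ range L, ‖c k‖ ^ 2 := by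
  have hcont : Continuous fun θ : ℝ => ∑ k ∈ range L, c k * expChar (θ * k) :=
    continuous_finsetSum _ fun k _ => continuous_const.mul (continuous_expChar.comp (by fun_prop))
  have e : ∀ θ : ℝ, ((‖∑ k ∈ range L, c k * expChar (θ * k)‖ ^ 2 : ℝ) : ℂ) =
      ∑ k ∈ range L, (starRingEnd ℂ) (c k) *
        ((∑ j ∈ range L, c j * expChar (θ * j)) * expChar (-(θ * k))) := fun θ => by
    rw [Complex.ofReal_pow, ← Complex.mul_conj', map_sum, mul_sum]
    refine sum_congr rfl fun k _ => ?_
    rw [map_mul, conj_expChar]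
    ring
  have h : ((∫ θ in (0 : ℝ)..1, ‖∑ k ∈ range L, c k * expChar (θ * k)‖ ^ 2 : ℝ) : ℂ) =
      ((∑ k ∈ range L, ‖c k‖ ^ 2 : ℝ) : ℂ) := by
    rw [← intervalIntegral.integral_ofReal]
    simp only [e]
    rw [intervalIntegral.integral_finsetSum]
    · push_cast
      refine sum_congr rfl fun k hk => ?_
      have := integral_sum_mul_expChar 0 L k (mem_range.mp hk) c
      rw [zero_add] at this
      rw [intervalIntegral.integral_const_mul, this, mul_comm, Complex.mul_conj']
    · intro k _
      exact (continuous_const.mul (hcont.mul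
        (continuous_expChar.comp (by fun_prop)))).intervalIntegrable _ _
  exact_mod_cast h

/-- The large sieve inequality for a trigonometric polynomial of degree `L`, with the constant
`δ⁻¹ + 4πL` that Gallagher's argument gives. -/
theorem large_sieve {ι : Type*} (I : Finset ι) (x : ι → ℝ) {δ : ℝ} (hδ0 : 0 < δ) (hδ1 : δ ≤ 1)
    (hx : ∀ i ∈ I, ∀ j ∈ I, i ≠ j → δ ≤ distNearestInt (x i - x j)) (L : ℕ) (c : ℕ → ℂ) :
    ∑ i ∈ I, ‖∑ k ∈ range (L + 1), c k * expChar (x i * k)‖ ^ 2 ≤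
      (δ⁻¹ + 4 * Real.pi * L) *
        ∫ θ in (0 : ℝ)..1, ‖∑ k ∈ range (L + 1), c k * expChar (θ * k)‖ ^ 2 := by
  obtain ⟨S, hS⟩ : ∃ S : ℝ → ℂ, S = fun θ => ∑ k ∈ range (L + 1), c k * expChar (θ * k) := ⟨_, rfl⟩
  obtain ⟨c', hc'⟩ : ∃ c' : ℕ → ℂ, c' = fun k => c k * (2 * Real.pi * Complex.I * k) := ⟨_, rfl⟩
  obtain ⟨T, hT⟩ : ∃ T : ℝ → ℂ, T = fun θ => ∑ k ∈ range (L + 1), c' k * expChar (θ * k) := ⟨_, rfl⟩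
  have hcont : ∀ a : ℕ → ℂ, Continuous fun θ : ℝ => ∑ k ∈ range (L + 1), a k * expChar (θ * k) :=
    fun a => continuous_finsetSum _ fun k _ =>
      continuous_const.mul (continuous_expChar.comp (by fun_prop))
  have hper : ∀ a : ℕ → ℂ, Function.Periodic
      (fun θ : ℝ => ∑ k ∈ range (L + 1), a k * expChar (θ * k)) 1 := fun a θ => by
    refine sum_congr rfl fun k _ => ?_
    rw [add_mul, one_mul]
    congr 1
    exact expChar_add_int _ (k : ℤ)
  have hSc : Continuous S := by rw [hS]; exact hcont c
  have hTc : Continuous T := by rw [hT]; exact hcont c'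
  have hderiv : ∀ θ, HasDerivAt S (T θ) θ := fun θ => by
    rw [hS, hT]
    refine HasDerivAt.fun_sum fun k _ => ?_
    have h1 : HasDerivAt (fun y : ℝ => 2 * (Real.pi : ℂ) * Complex.I * ((y * (k : ℝ) : ℝ) : ℂ))
        (2 * Real.pi * Complex.I * k) θ := by
      have := (((hasDerivAt_id θ).mul_const (k : ℝ)).ofReal_comp).const_mul
        (2 * (Real.pi : ℂ) * Complex.I)
      refine this.congr_deriv ?_
      simp
    have h2 := (h1.cexp).const_mul (c k)
    refine h2.congr_deriv ?_
    rw [hc']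
    unfold expChar
    ring
  have hderiv2 : ∀ θ, HasDerivAt (fun θ => ‖S θ‖ ^ 2) (2 * inner ℝ (S θ) (T θ)) θ :=
    fun θ => (hderiv θ).norm_sq
  have hSint : ∫ θ in (0 : ℝ)..1, ‖S θ‖ ^ 2 = ∑ k ∈ range (L + 1), ‖c k‖ ^ 2 := by
    rw [hS]; exact integral_norm_sum_expChar_sq _ c
  have hTint : ∫ θ in (0 : ℝ)..1, ‖T θ‖ ^ 2 ≤ (2 * Real.pi * L) ^ 2 * ∫ θ in (0 : ℝ)..1, ‖S θ‖ ^ 2 := by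
    rw [hSint, hT, integral_norm_sum_expChar_sq, mul_sum]
    refine sum_le_sum fun k hk => ?_
    have hk' : (k : ℝ) ≤ L := by exact_mod_cast Nat.lt_succ_iff.mp (mem_range.mp hk)
    have e : ‖c' k‖ = ‖c k‖ * (2 * Real.pi * k) := by
      rw [hc']
      simp [abs_of_pos Real.pi_pos]
    rw [e, mul_pow, mul_comm]
    gcongr
  obtain ⟨J, hJ⟩ : ∃ J : ℝ, J = ∫ θ in (0 : ℝ)..1, ‖S θ‖ ^ 2 := ⟨_, rfl⟩
  have hJ0 : 0 ≤ J := by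
    rw [hJ]; exact intervalIntegral.integral_nonneg zero_le_one fun _ _ => by positivity
  obtain ⟨Λ, hΛ0, hΛ⟩ : ∃ Λ : ℝ, 0 ≤ Λ ∧ Λ = 2 * Real.pi * L := ⟨_, by positivity, rfl⟩
  obtain ⟨G, hG⟩ : ∃ G : ℝ → ℝ, G = fun θ => Λ * ‖S θ‖ ^ 2 + Λ⁻¹ * ‖T θ‖ ^ 2 := ⟨_, rfl⟩
  have hGc : Continuous G := by rw [hG]; fun_prop
  -- when `L = 0` the weight `Λ⁻¹` is the junk value `0`, but then the sum is constant
  have hT0 : Λ = 0 → ∀ θ, T θ = 0 := fun h θ => by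
    have hL : L = 0 := by
      have := hΛ.symm.trans h
      simpa [Real.pi_ne_zero] using this
    rw [hT, hc', hL]
    simp
  have hFG : ∀ θ, |2 * inner ℝ (S θ) (T θ)| ≤ G θ := fun θ => by
    rw [abs_mul, abs_of_pos (two_pos : (0 : ℝ) < 2)]
    refine (mul_le_mul_of_nonneg_left (abs_real_inner_le_norm _ _) two_pos.le).trans ?_
    rw [hG]
    rcases hΛ0.eq_or_lt with h | h
    · simp [hT0 h.symm θ, ← h]
    · have h1 : 0 ≤ Λ⁻¹ * (Λ * ‖S θ‖ - ‖T θ‖) ^ 2 := by positivity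
      have h2 : Λ⁻¹ * (Λ * ‖S θ‖ - ‖T θ‖) ^ 2 =
          Λ * ‖S θ‖ ^ 2 + Λ⁻¹ * ‖T θ‖ ^ 2 - 2 * (‖S θ‖ * ‖T θ‖) := by
        field_simp
        ring
      linarith
  have hGint : ∫ θ in (0 : ℝ)..1, G θ ≤ 4 * Real.pi * L * J := by
    rw [hG, intervalIntegral.integral_add (Continuous.intervalIntegrable (by fun_prop) _ _)
      (Continuous.intervalIntegrable (by fun_prop) _ _), intervalIntegral.integral_const_mul,
      intervalIntegral.integral_const_mul, ← hJ]
    have h1 : Λ⁻¹ * (∫ θ in (0 : ℝ)..1, ‖T θ‖ ^ 2) ≤ Λ * J := by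
      refine (mul_le_mul_of_nonneg_left hTint (inv_nonneg.mpr hΛ0)).trans (le_of_eq ?_)
      rw [← hΛ, ← hJ]
      rcases hΛ0.eq_or_lt with h | h
      · simp [← h]
      · field_simp
    have h2 : 4 * Real.pi * L = Λ + Λ := by rw [hΛ]; ring
    rw [h2]
    linarith
  have hmain := sum_integral_le_of_spaced I x hδ0 hδ1 hx
    (H := fun t => δ⁻¹ * ‖S t‖ ^ 2 + G t) (fun t => by
      have h1 : S (t + 1) = S t := by rw [hS]; exact hper c t
      have h2 : T (t + 1) = T t := by rw [hT]; exact hper c' t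
      simp only [hG, h1, h2]) (by fun_prop) (fun t => by rw [hG]; positivity)
  have hsum : ∑ i ∈ I, ‖S (x i)‖ ^ 2 ≤
      ∑ i ∈ I, ∫ t in (x i - δ / 2)..(x i + δ / 2), (δ⁻¹ * ‖S t‖ ^ 2 + G t) :=
    sum_le_sum fun i _ => le_integral_of_abs_deriv_le hderiv2
      (continuous_const.mul (hSc.inner hTc)) hGc hFG (x i) hδ0
  have htotal := hsum.trans hmain
  rw [intervalIntegral.integral_add (Continuous.intervalIntegrable (by fun_prop) _ _)
    (hGc.intervalIntegrable _ _), intervalIntegral.integral_const_mul, ← hJ] at htotal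
  have hfin : ∑ i ∈ I, ‖S (x i)‖ ^ 2 ≤ (δ⁻¹ + 4 * Real.pi * L) * J := by linarith
  rw [hJ, hS] at hfin
  exact hfin

/-! ### Moments of `Φ_N` -/

theorem sub_one_mul_sum_pow_add_pow_le {b : ℕ} (hb : 1 ≤ b) (M : ℕ) :
    (b - 1) * ∑ n ∈ Ico 1 (M + 1), (b ^ n + b ^ (2 * (M + 1) - n)) + b ≤ b ^ (2 * (M + 1)) := by
  induction M with
  | zero => simpa using Nat.le_self_pow (by norm_num) b
  | succ M ih =>
    have hrec : ∑ n ∈ Ico 1 (M + 1 + 1), (b ^ n + b ^ (2 * (M + 1 + 1) - n)) =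
        (b + b ^ (2 * M + 3)) + b * ∑ n ∈ Ico 1 (M + 1), (b ^ n + b ^ (2 * (M + 1) - n)) := by
      rw [sum_eq_sum_Ico_succ_bot (by omega), ← sum_Ico_add' _ 1 (M + 1) 1, mul_sum, pow_one]
      congr 1
      refine sum_congr rfl fun n hn => ?_
      rw [mem_Ico] at hn
      have e : 2 * (M + 1 + 1) - (n + 1) = (2 * (M + 1) - n) + 1 := by omega
      rw [e]
      ring
    rw [hrec]
    obtain ⟨d, rfl⟩ : ∃ d, b = d + 1 := ⟨b - 1, by omega⟩
    simp only [Nat.add_sub_cancel] at ih ⊢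
    have e : (d + 1) ^ (2 * (M + 1 + 1)) = (d + 1) * (d + 1) ^ (2 * M + 3) := by ring
    have e' : (d + 1) ^ (2 * M + 3) = (d + 1) * (d + 1) ^ (2 * (M + 1)) := by ring
    have h := Nat.mul_le_mul_left (d + 1) ih
    rw [← e'] at h
    rw [e]
    linarith

/-- `Φ_N^(2K)` is the square of the modulus of a trigonometric polynomial of degree at most
`K b^(2N)`. -/
theorem exists_bigPhi_pow_eq_norm_sq {b : ℕ} (hb : 1 ≤ b) (K M : ℕ) : ∃ c : ℕ → ℂ, ∀ α : ℝ,
    bigPhi b (M + 1) α ^ (2 * K) =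
      ‖∑ k ∈ range (K * b ^ (2 * (M + 1)) + 1), c k * expChar (α * k)‖ ^ 2 := by
  obtain ⟨p, hp⟩ : ∃ p : Polynomial ℂ, p = (∏ n ∈ Ico 1 (M + 1), ∑ m ∈ range b,
      (Polynomial.X : Polynomial ℂ) ^ (m * (b ^ n + b ^ (2 * (M + 1) - n)))) ^ K := ⟨_, rfl⟩
  have hdeg : p.natDegree < K * b ^ (2 * (M + 1)) + 1 := by
    rw [hp]
    refine Nat.lt_succ_of_le (Polynomial.natDegree_pow_le.trans (Nat.mul_le_mul_left _ ?_))
    refine (Polynomial.natDegree_prod_le _ _).trans ?_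
    refine le_trans (sum_le_sum (g := fun n => (b - 1) * (b ^ n + b ^ (2 * (M + 1) - n)))
      fun n _ => Polynomial.natDegree_sum_le_of_forall_le _ _ fun m hm => ?_) ?_
    · refine (Polynomial.natDegree_X_pow_le _).trans (Nat.mul_le_mul_right _ ?_)
      have := mem_range.mp hm
      omega
    · rw [← mul_sum]
      exact (Nat.le_add_right _ _).trans (sub_one_mul_sum_pow_add_pow_le hb M)
  refine ⟨p.coeff, fun α => ?_⟩
  have h := Polynomial.eval_eq_sum_range' hdeg (expChar α)
  simp only [expChar_pow] at h
  rw [← h, hp, Polynomial.eval_pow, Polynomial.eval_prod, norm_pow, norm_prod, ← pow_mul, mul_comm K 2]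
  unfold bigPhi phi
  congr 1
  refine prod_congr rfl fun n _ => ?_
  rw [Polynomial.eval_finsetSum]
  congr 1
  refine sum_congr rfl fun m _ => ?_
  rw [Polynomial.eval_pow, Polynomial.eval_X, expChar_pow]
  congr 1
  push_cast
  ring

theorem sum_bigPhi_pow_le_mul_integral {b : ℕ} (hb : 1 ≤ b) (K M : ℕ) {ι : Type*} (I : Finset ι)
    (x : ι → ℝ) {δ : ℝ} (hδ0 : 0 < δ) (hδ1 : δ ≤ 1)
    (hx : ∀ i ∈ I, ∀ j ∈ I, i ≠ j → δ ≤ distNearestInt (x i - x j)) :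
    ∑ i ∈ I, bigPhi b (M + 1) (x i) ^ (2 * K) ≤ (δ⁻¹ + K * (b : ℝ) ^ (2 * (M + 1))) *
      (13 * ∫ α in (0 : ℝ)..1, bigPhi b (M + 1) α ^ (2 * K)) := by
  obtain ⟨c, hc⟩ := exists_bigPhi_pow_eq_norm_sq hb K M
  have h := large_sieve I x hδ0 hδ1 hx (K * b ^ (2 * (M + 1))) c
  simp only [← hc] at h
  refine h.trans ?_
  have h0 : 0 ≤ ∫ α in (0 : ℝ)..1, bigPhi b (M + 1) α ^ (2 * K) :=
    intervalIntegral.integral_nonneg zero_le_one fun α _ => pow_nonneg (bigPhi_nonneg _ _ _) _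
  rw [← mul_assoc]
  refine mul_le_mul_of_nonneg_right ?_ h0
  push_cast
  have h1 : 0 < δ⁻¹ := inv_pos.mpr hδ0
  have h2 : 0 ≤ (K : ℝ) * (b : ℝ) ^ (2 * (M + 1)) := by positivity
  have h3 : 4 * Real.pi ≤ 13 := by linarith [Real.pi_lt_d2]
  nlinarith

theorem thirteen_mul_exp_le {K b : ℕ} (hb : 2 ≤ b) (hK : 100 ≤ K) :
    13 * Real.exp (3 * K / (b : ℝ) ^ 2) ≤ (b : ℝ) ^ (2 * K) := by
  have hb' : (2 : ℝ) ≤ b := by exact_mod_cast hb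
  have hK' : (100 : ℝ) ≤ K := by exact_mod_cast hK
  have h1 : Real.exp (3 / 4) ≤ 2.2 := by
    have h3 : Real.exp (3 / 4) ^ 4 ≤ 2.2 ^ 4 := by
      rw [← Real.exp_nat_mul]
      have e : ((4 : ℕ) : ℝ) * (3 / 4) = (3 : ℕ) * 1 := by norm_num
      rw [e, Real.exp_nat_mul]
      have := Real.exp_one_lt_d9
      calc Real.exp 1 ^ 3 ≤ 2.7182818286 ^ 3 := pow_le_pow_left₀ (Real.exp_pos _).le this.le 3
        _ ≤ 2.2 ^ 4 := by norm_num
    exact le_of_pow_le_pow_left₀ (by norm_num) (by norm_num) h3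
  have h2 : Real.exp (3 * K / (b : ℝ) ^ 2) ≤ 2.2 ^ K := by
    calc Real.exp (3 * K / (b : ℝ) ^ 2) ≤ Real.exp (K * (3 / 4)) := by
          apply Real.exp_le_exp.mpr
          rw [div_le_iff₀ (by positivity)]
          nlinarith [mul_nonneg (by linarith : (0 : ℝ) ≤ K) (by nlinarith : (0 : ℝ) ≤ (b : ℝ) ^ 2 - 4)]
      _ = Real.exp (3 / 4) ^ K := Real.exp_nat_mul _ _
      _ ≤ _ := pow_le_pow_left₀ (Real.exp_pos _).le h1 K
  have h4 : (13 : ℝ) ≤ 1.8 ^ K := by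
    have := one_add_mul_le_pow (a := (0.8 : ℝ)) (by norm_num) K
    norm_num at this ⊢
    linarith
  calc 13 * Real.exp (3 * K / (b : ℝ) ^ 2) ≤ 1.8 ^ K * 2.2 ^ K :=
        mul_le_mul h4 h2 (Real.exp_pos _).le (by positivity)
    _ = (1.8 * 2.2) ^ K := (mul_pow _ _ _).symm
    _ ≤ ((b : ℝ) ^ 2) ^ K := pow_le_pow_left₀ (by norm_num) (by nlinarith) K
    _ = _ := (pow_mul _ _ _).symm

/-- The main estimate when `K` is large compared with `b`, with room for the constant of the large
sieve. -/
theorem exists_thirteen_mul_integral_le : ∃ C₀ : ℝ, 0 < C₀ ∧ ∀ C : ℝ, C₀ ≤ C →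
    ∀ M K b : ℕ, 2 ≤ b → b ≤ K → 100 ≤ K →
    13 * ∫ α in (0 : ℝ)..1, bigPhi b (M + 1) α ^ (2 * K) ≤ momentBound C (M + 1) K b := by
  obtain ⟨C₀, hC0, hC⟩ := exists_carryCount_le
  refine ⟨C₀, hC0, fun C hCC M K b hb hbK hK => ?_⟩
  have hb' : (2 : ℝ) ≤ b := by exact_mod_cast hb
  have hK0 : (0 : ℝ) < K := by exact_mod_cast (by omega : 0 < K)
  rw [integral_bigPhi_pow (by omega)]
  have h := hC K b hb hbK hK M 0 0 (by simp)
  simp only [Int.cast_zero, ne_eq, OfNat.ofNat_ne_zero, not_false_eq_true, zero_pow, zero_mul,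
    zero_div, neg_zero, Real.exp_zero, mul_one] at h
  obtain ⟨u, hu⟩ : ∃ u : ℝ, u = 1 / Real.sqrt K := ⟨_, rfl⟩
  obtain ⟨w, hw⟩ : ∃ w : ℝ, w = (b : ℝ) ^ 2 / K := ⟨_, rfl⟩
  have hu0 : 0 ≤ u := by rw [hu]; positivity
  have hw0 : 0 ≤ w := by rw [hw]; positivity
  have hfac : (1 + C₀ / Real.sqrt K) * (1 + C₀ * ((b : ℝ) ^ 2 / K)) ≤ (1 + C * (u + w)) ^ 2 := by
    rw [show C₀ / Real.sqrt K = C₀ * u by rw [hu]; ring, ← hw, pow_two]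
    have h1 : C₀ * u ≤ C * (u + w) := mul_le_mul hCC (by linarith) hu0 (by linarith)
    have h2 : C₀ * w ≤ C * (u + w) := mul_le_mul hCC (by linarith) hw0 (by linarith)
    have h3 : 0 ≤ C₀ * w := by positivity
    have h4 : 0 ≤ C₀ * u := by positivity
    exact mul_le_mul (by linarith) (by linarith) (by linarith) (by linarith)
  have hdiv : (b : ℝ) ^ (2 * K) / (b : ℝ) ^ 2 = (b : ℝ) ^ (2 * (K - 1)) := by
    rw [div_eq_iff (by positivity), ← pow_add]
    congr 1
    omega
  have hone : 1 ≤ 1 + C * (u + w) := by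
    have : 0 ≤ C * (u + w) := mul_nonneg (by linarith) (by linarith)
    linarith
  unfold momentBound
  rw [← hu, ← hw]
  calc 13 * carryCount b K M 0 0 ≤ 13 * (Real.exp (3 * K / (b : ℝ) ^ 2) *
        ((b : ℝ) ^ (2 * (K - 1)) * (1 + C * (u + w)) ^ 2) ^ M) := by
        rw [hdiv] at h
        refine mul_le_mul_of_nonneg_left (h.trans ?_) (by norm_num)
        gcongr
    _ = (13 * Real.exp (3 * K / (b : ℝ) ^ 2)) * ((b : ℝ) ^ (2 * (K - 1) * M) *
        (1 + C * (u + w)) ^ (2 * M)) := by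
        rw [mul_pow, ← pow_mul, ← pow_mul]
        ring
    _ ≤ (b : ℝ) ^ (2 * K) * ((b : ℝ) ^ (2 * (K - 1) * M) * (1 + C * (u + w)) ^ (2 * (M + 1))) := by
        refine mul_le_mul (thirteen_mul_exp_le hb hK) ?_ (by positivity) (by positivity)
        refine mul_le_mul_of_nonneg_left (pow_le_pow_right₀ hone (by omega)) (by positivity)
    _ = _ := by
        rw [← mul_assoc, ← pow_add]
        congr 2
        obtain ⟨l, rfl⟩ : ∃ l, K = l + 1 := ⟨K - 1, by omega⟩
        rw [Nat.add_sub_cancel]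
        ring

/-- When `K` is small compared with `b` the trivial bound `Φ_N ≤ b^(N-1)` suffices. -/
theorem bigPhi_pow_le_momentBound {C : ℝ} (hC : 100 ≤ C) {N K b : ℕ} (hN : 1 ≤ N) (hK : 1 ≤ K)
    (hb : 2 ≤ b) (h : K < b ∨ K < 100) (α : ℝ) :
    bigPhi b N α ^ (2 * K) ≤ momentBound C N K b := by
  have hb' : (2 : ℝ) ≤ b := by exact_mod_cast hb
  have hK0 : (0 : ℝ) < K := by exact_mod_cast hK
  have hfac : (b : ℝ) ≤ 1 + C * (1 / Real.sqrt K + (b : ℝ) ^ 2 / K) := by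
    have h1 : (0 : ℝ) ≤ 1 / Real.sqrt K := by positivity
    have h2 : (b : ℝ) ≤ 100 * ((b : ℝ) ^ 2 / K) := by
      rw [← mul_div_assoc, le_div_iff₀ hK0]
      have h3 : (K : ℝ) ≤ 100 * b := by
        rcases h with h | h
        · have : (K : ℝ) < b := by exact_mod_cast h
          linarith
        · have : (K : ℝ) < 100 := by exact_mod_cast h
          linarith
      nlinarith
    have h4 : 100 * ((b : ℝ) ^ 2 / K) ≤ C * (1 / Real.sqrt K + (b : ℝ) ^ 2 / K) :=
      mul_le_mul hC (by linarith) (by positivity) (by linarith)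
    linarith
  unfold momentBound
  calc bigPhi b N α ^ (2 * K) ≤ ((b : ℝ) ^ (N - 1)) ^ (2 * K) :=
        pow_le_pow_left₀ (bigPhi_nonneg _ _ _) (bigPhi_le b N α) _
    _ = (b : ℝ) ^ ((N - 1) * (2 * K)) := (pow_mul _ _ _).symm
    _ ≤ (b : ℝ) ^ (2 * (K - 1) * N + 2 + 2 * N) := by
        refine pow_le_pow_right₀ (by linarith) ?_
        obtain ⟨l, rfl⟩ : ∃ l, K = l + 1 := ⟨K - 1, by omega⟩
        obtain ⟨M, rfl⟩ : ∃ M, N = M + 1 := ⟨N - 1, by omega⟩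
        simp only [Nat.add_sub_cancel]
        nlinarith
    _ = (b : ℝ) ^ (2 * (K - 1) * N + 2) * (b : ℝ) ^ (2 * N) := pow_add _ _ _
    _ ≤ _ := by gcongr

/-- Distinct reduced fractions with denominators at most `Q` are `Q⁻²`-spaced modulo `1`. -/
theorem inv_sq_le_distNearestInt_sub {Q β : ℝ} {q r h k : ℕ} (hq : 1 ≤ q) (hr : 1 ≤ r)
    (hqQ : (q : ℝ) ≤ Q) (hrQ : (r : ℝ) ≤ Q) (hhq : h < q) (hkr : k < r) (hh : Nat.Coprime h q)
    (hk : Nat.Coprime k r) (hne : ¬ (q = r ∧ h = k)) :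
    (Q ^ 2)⁻¹ ≤ distNearestInt ((h : ℝ) / q + β - ((k : ℝ) / r + β)) := by
  have hq0 : (0 : ℝ) < q := by exact_mod_cast hq
  have hr0 : (0 : ℝ) < r := by exact_mod_cast hr
  unfold distNearestInt
  set z := round ((h : ℝ) / q + β - ((k : ℝ) / r + β)) with hz
  have e : (h : ℝ) / q + β - ((k : ℝ) / r + β) - z =
      ((h * r - k * q - z * (q * r) : ℤ) : ℝ) / (q * r) := by
    push_cast
    field_simp
    ring
  have hnum : (h * r - k * q - z * (q * r) : ℤ) ≠ 0 := by
    intro h0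
    -- modulo `q` and modulo `r` the relation forces the two denominators to divide each other
    have hqr : q ∣ r := by
      have h1 : (q : ℤ) ∣ h * r := ⟨k + z * r, by linarith⟩
      have h2 : q ∣ h * r := by exact_mod_cast h1
      exact hh.symm.dvd_of_dvd_mul_left h2
    have hrq : r ∣ q := by
      have h1 : (r : ℤ) ∣ k * q := ⟨h - z * q, by linarith⟩
      have h2 : r ∣ k * q := by exact_mod_cast h1
      exact hk.symm.dvd_of_dvd_mul_left h2
    have hqreq : q = r := Nat.dvd_antisymm hqr hrq
    subst hqreq
    refine hne ⟨rfl, ?_⟩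
    have hqZ : (q : ℤ) ≠ 0 := by positivity
    have h3 : (h : ℤ) - k = z * q := by
      have : (q : ℤ) * ((h : ℤ) - k - z * q) = 0 := by linarith
      rcases mul_eq_zero.mp this with h4 | h4
      · exact absurd h4 hqZ
      · linarith
    have h5 : (q : ℤ) ∣ (h : ℤ) - k := ⟨z, by linarith⟩
    have h6 := Int.eq_zero_of_abs_lt_dvd h5 (by rw [abs_lt]; omega)
    omega
  rw [e, abs_div, abs_of_pos (mul_pos hq0 hr0), ← Int.cast_abs]
  have h1 : (1 : ℝ) ≤ ((|(h * r - k * q - z * (q * r) : ℤ)| : ℤ) : ℝ) := by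
    exact_mod_cast Int.one_le_abs hnum
  have h2 : (q : ℝ) * r ≤ Q ^ 2 := by
    rw [pow_two]
    exact mul_le_mul hqQ hrQ hr0.le (hq0.le.trans hqQ)
  calc (Q ^ 2)⁻¹ ≤ ((q : ℝ) * r)⁻¹ := by gcongr
    _ = 1 / ((q : ℝ) * r) := (one_div _).symm
    _ ≤ _ := by gcongr

theorem mainTheorem3 :
    ∃ C : ℝ, 0 < C ∧ ∀ N K b : ℕ, 2 ≤ N → 2 ≤ K → 2 ≤ b →
      (∫ α in (0 : ℝ)..1, bigPhi b N α ^ (2 * K)) ≤ momentBound C N K b ∧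
      (∀ (R : ℕ) (δ : ℝ) (α : Fin R → ℝ), 0 < δ → δ ≤ 1 / 2 → IsSpaced δ α →
        ∑ r : Fin R, bigPhi b N (α r) ^ (2 * K) ≤
          (δ⁻¹ + (K : ℝ) * (b : ℝ) ^ (2 * N)) * momentBound C N K b) ∧
      (∀ Q β : ℝ, 1 ≤ Q →
        ∑ q ∈ Finset.Icc 1 ⌊Q⌋₊, ∑ h ∈ (Finset.range q).filter (fun h => Nat.Coprime h q),
            bigPhi b N ((h : ℝ) / (q : ℝ) + β) ^ (2 * K) ≤
          (Q ^ 2 + (K : ℝ) * (b : ℝ) ^ (2 * N)) * momentBound C N K b) := by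
  obtain ⟨C₀, hC0, hC⟩ := exists_thirteen_mul_integral_le
  refine ⟨C₀ + 100, by positivity, fun N K b hN hK hb => ?_⟩
  obtain ⟨M, rfl⟩ : ∃ M, N = M + 1 := ⟨N - 1, by omega⟩
  obtain ⟨B, hB⟩ : ∃ B : ℝ, B = momentBound (C₀ + 100) (M + 1) K b := ⟨_, rfl⟩
  have hB0 : 0 ≤ B := by rw [hB]; unfold momentBound; positivity
  have hint0 : 0 ≤ ∫ α in (0 : ℝ)..1, bigPhi b (M + 1) α ^ (2 * K) :=
    intervalIntegral.integral_nonneg zero_le_one fun α _ => pow_nonneg (bigPhi_nonneg _ _ _) _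
  rw [← hB]
  have hcases : (13 * ∫ α in (0 : ℝ)..1, bigPhi b (M + 1) α ^ (2 * K)) ≤ B ∨
      ∀ α, bigPhi b (M + 1) α ^ (2 * K) ≤ B := by
    rw [hB]
    by_cases h : K < b ∨ K < 100
    · exact Or.inr fun α => bigPhi_pow_le_momentBound (by linarith) (by omega) (by omega) hb h α
    · exact Or.inl (hC _ (by linarith) M K b hb (by omega) (by omega))
  have hsum : ∀ {ι : Type} (I : Finset ι) (x : ι → ℝ) (δ : ℝ), 0 < δ → δ ≤ 1 →
      (∀ i ∈ I, ∀ j ∈ I, i ≠ j → δ ≤ distNearestInt (x i - x j)) →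
      ∑ i ∈ I, bigPhi b (M + 1) (x i) ^ (2 * K) ≤
        (δ⁻¹ + (K : ℝ) * (b : ℝ) ^ (2 * (M + 1))) * B := by
    intro ι I x δ hδ0 hδ1 hx
    have hinv : 0 < δ⁻¹ := inv_pos.mpr hδ0
    have hKb : (0 : ℝ) ≤ (K : ℝ) * (b : ℝ) ^ (2 * (M + 1)) := by positivity
    rcases hcases with h | h
    · exact (sum_bigPhi_pow_le_mul_integral (by omega) K M I x hδ0 hδ1 hx).trans
        (mul_le_mul_of_nonneg_left h (by linarith))
    · refine (sum_le_sum fun i _ => h (x i)).trans ?_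
      rw [sum_const, nsmul_eq_mul]
      refine mul_le_mul_of_nonneg_right ?_ hB0
      linarith [card_le_inv_of_spaced I x hδ0 hδ1 hx]
  refine ⟨?_, fun R δ α hδ0 hδ hα => ?_, fun Q β hQ => ?_⟩
  · rcases hcases with h | h
    · linarith
    · have hcont : Continuous fun α => bigPhi b (M + 1) α ^ (2 * K) := (continuous_bigPhi _ _).pow _
      have := intervalIntegral.integral_mono_on zero_le_one (hcont.intervalIntegrable 0 1)
        (continuous_const.intervalIntegrable (μ := MeasureTheory.volume) 0 1) fun α _ => h α
      simpa using this
  · exact hsum univ α δ hδ0 (by linarith) fun i _ j _ hij => hα i j hij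
  · rw [sum_sigma']
    have hmem : ∀ i ∈ (Icc 1 ⌊Q⌋₊).sigma fun q => (range q).filter fun h => Nat.Coprime h q,
        1 ≤ i.1 ∧ (i.1 : ℝ) ≤ Q ∧ i.2 < i.1 ∧ Nat.Coprime i.2 i.1 := fun i hi => by
      rw [mem_sigma, mem_Icc, mem_filter, mem_range] at hi
      exact ⟨hi.1.1, (Nat.le_floor_iff (by linarith)).mp hi.1.2, hi.2⟩
    have h := hsum ((Icc 1 ⌊Q⌋₊).sigma fun q => (range q).filter fun h => Nat.Coprime h q)
      (fun i => (i.2 : ℝ) / (i.1 : ℝ) + β) (Q ^ 2)⁻¹ (by positivity)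
      (inv_le_one_of_one_le₀ (one_le_pow₀ hQ)) (by
        intro i hi j hj hij
        obtain ⟨h1, h2, h3, h4⟩ := hmem i hi
        obtain ⟨k1, k2, k3, k4⟩ := hmem j hj
        refine inv_sq_le_distNearestInt_sub h1 k1 h2 k2 h3 k3 h4 k4 fun hc => hij ?_
        obtain ⟨q, h⟩ := i
        obtain ⟨r, k⟩ := j
        obtain ⟨rfl, rfl⟩ := hc
        rfl)
    rwa [inv_inv] at h
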